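/- Let $0<\tau<2\pi$ and consider the slow-fast Hamiltonian system with phase $u\in S^1=\mathbb R/2\pi\mathbb Z$, $$H=v+\tfrac12y^2\bigl(1+M(x^2,y^2,u)\bigr)-\tfrac12f(u)x^2+\tfrac12x^4\bigl(1+V(x^2,u)\bigr),\qquad \omega=dx\wedge dy+\epsilon^{-1}du\wedge dv,$$ that is, $\dot x=\partial_yH$, $\dot y=-\partial_xH$, $\dot u=\epsilon$. Here $f,M,V$ are smooth and $2\pi$-periodic in $u$, $f(0)=f(\tau)=0$, $f'(0)=1$, $M(0,0,0)=0$, $V(0,0)=0$; $f>0$ on $(0,\tau)$ and $f<0$ on $(\tau,2\pi)$; $f,M,V$ are invariant under $u\mapsto\tau-u$; $1+M>0$; and for $u\in(0,\tau)$ there is a smooth $\kappa(u)>0$ with $\partial_{x^2}H=0$ and $\partial_{x^2}^2H>0$ at $(x^2,y^2)=(\kappa(u)^2,0)$. For $\epsilon,\delta>0$ put $\mu=\epsilon^{1/3}\delta^{-1/2}$, $\hat u=\mu^{-2}u$ and $\hat F=\mu^{-1}\bigl(-f(u)(1+M(0,0,u))\bigr)^{1/2}$. For $u\in[-\pi+\tau/2,0)$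 define action-angle variables $(\hat z_0,w_0)$, $\hat z_0>0$, by $$x=\mu\delta^{3/4}\hat F^{-1/2}(1+M(0,0,u))^{1/2}\sqrt{2\hat z_0}\cos w_0,\qquad y=\mu^2\delta^{3/4}\hat F^{1/2}(1+M(0,0,u))^{-1/2}\sqrt{2\hat z_0}\sin w_0 .$$ For fixed $\hat u_*>0$ let $P_o$ be the outer map, which sends the value of $(\hat z_0,w_0)$ at $u=-\pi+\tau/2$ to its value at $\hat u=-\hat u_*$ along the solution, the angle $w_0$ being followed continuously. Let $$e_3=\int_0^{\pi-\tau/2}\bigl(-f(-u)\,(1+M(0,0,-u))\bigr)^{1/2}du .$$ Proposition. There is a constant $e_4>0$, depending only on the system $(f,M,V,\tau)$, such that for every $\hat u_*>0$ and every $K>0$ there are constants $c,C>0$ with the following property. If $0<\epsilon\le c$, $\delta>0$, $\mu\le c$ and $\delta^{3/2}\ln\epsilon^{-1}\le c$ (that is, $\epsilon\ll1$, $\mu\ll1$, $\delta^{3/2}\ln\epsilon^{-1}\ll1$), then for all $0<\hat z_0\le K$ and all $w_0\in\mathbb R$ the value $P_o(\hat z_0,w_0)$ is well defined, and $$P_o(\hat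 z_0,w_0)=\begin{pmatrix}\hat z_0+R_1\\ w_0-\epsilon^{-1}e_3-\bigl(\ln(e_4\epsilon^{-1})-\tfrac32\ln(\delta^{-1}\hat u_*)\bigr)\hat z_0+\tfrac23\delta^{-3/2}\hat u_*^{3/2}+R_2\end{pmatrix}$$ with $$|R_1|\le C\,\delta^{3/2}\ln\epsilon^{-1},\qquad |R_2|\le C\bigl(\delta^{3/2}\ln\epsilon^{-1}+\epsilon^{2/3}\delta^{-5/2}\bigr).$$ In particular both remainders are $O(\delta^{3/2}\ln\epsilon^{-1})$ whenever $\epsilon^{2/3}=O(\delta^{4}\ln\epsilon^{-1})$. -/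

import Mathlib

open Real Set

open scoped ContDiff

noncomputable section

/-- The Hamiltonian `H(u, v, x², y²)`, with `a = x²` and `b = y²`. -/
def hamiltonian (f : ℝ → ℝ) (M : ℝ → ℝ → ℝ → ℝ) (V : ℝ → ℝ → ℝ) (u v a b : ℝ) : ℝ :=
  v + 1 / 2 * b * (1 + M a b u) - 1 / 2 * f u * a + 1 / 2 * a ^ 2 * (1 + V a u)

/-- The standing assumptions on the system. A function on `S¹ = ℝ / 2πℤ` is a `2π`-periodic
function on `ℝ`; `M a b u` and `V a u` are only constrained for `a, b ≥ 0`, since `a = x²` and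
`b = y²`. -/
structure IsSlowFastSystem (f : ℝ → ℝ) (M : ℝ → ℝ → ℝ → ℝ) (V : ℝ → ℝ → ℝ) (τ : ℝ) : Prop where
  smooth_f : ContDiff ℝ ∞ f
  smooth_M : ContDiffOn ℝ ∞ (fun p : ℝ × ℝ × ℝ => M p.1 p.2.1 p.2.2)
    (Ici 0 ×ˢ (Ici 0 ×ˢ univ))
  smooth_V : ContDiffOn ℝ ∞ (fun p : ℝ × ℝ => V p.1 p.2) (Ici 0 ×ˢ univ)
  periodic_f : ∀ u, f (u + 2 * π) = f u
  periodic_M : ∀ a b u, 0 ≤ a → 0 ≤ b → M a b (u + 2 * π) = M a b u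
  periodic_V : ∀ a u, 0 ≤ a → V a (u + 2 * π) = V a u
  M_zero : M 0 0 0 = 0
  V_zero : V 0 0 = 0
  f_zero : f 0 = 0
  deriv_f_zero : deriv f 0 = 1
  tau_pos : 0 < τ
  tau_lt : τ < 2 * π
  f_tau : f τ = 0
  f_pos : ∀ u ∈ Ioo 0 τ, 0 < f u
  f_neg : ∀ u ∈ Ioo τ (2 * π), f u < 0
  symm_f : ∀ u, f (τ - u) = f u
  symm_M : ∀ a b u, 0 ≤ a → 0 ≤ b → M a b (τ - u) = M a b u
  symm_V : ∀ a u, 0 ≤ a → V a (τ - u) = V a u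
  one_add_M_pos : ∀ a b u, 0 ≤ a → 0 ≤ b → 0 < 1 + M a b u
  /-- The bifurcating critical points `x² = κ(u)²`, `y = 0` exist, depend smoothly on `u`, and are
  nondegenerate for `0 < u < τ`. -/
  branch : ∃ κ : ℝ → ℝ, ContDiffOn ℝ ∞ κ (Ioo 0 τ) ∧ ∀ u ∈ Ioo 0 τ, 0 < κ u ∧
    deriv (fun a => hamiltonian f M V u 0 a 0) (κ u ^ 2) = 0 ∧
    0 < iteratedDeriv 2 (fun a => hamiltonian f M V u 0 a 0) (κ u ^ 2)

/-- `(x, y)`, as functions of `u` on `[u₀, u₁]`, solve the equations of motion `x' = ∂H/∂y`,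
`y' = -∂H/∂x`, `u' = ε` with `u` used as the independent variable. The equations do not
involve `v`. -/
def SolvesMotion (f : ℝ → ℝ) (M : ℝ → ℝ → ℝ → ℝ) (V : ℝ → ℝ → ℝ) (ε u₀ u₁ : ℝ)
    (x y : ℝ → ℝ) : Prop :=
  ∀ u ∈ Icc u₀ u₁,
    HasDerivWithinAt x
      (ε⁻¹ * deriv (fun s => hamiltonian f M V u 0 (x u ^ 2) (s ^ 2)) (y u)) (Icc u₀ u₁) u ∧
    HasDerivWithinAt y
      (-(ε⁻¹ * deriv (fun s => hamiltonian f M V u 0 (s ^ 2) (y u ^ 2)) (x u))) (Icc u₀ u₁) u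

/-- The scale `μ = ε^{1/3} δ^{-1/2}`. The scaled phase is `û = μ⁻² u`. -/
def scaleMu (ε δ : ℝ) : ℝ := ε ^ (1 / 3 : ℝ) * δ ^ (-(1 / 2) : ℝ)

/-- The scaled frequency `F̂ = μ⁻¹ √(-f(u) (1 + M(0,0,u)))` at `û = μ⁻² u`. -/
def scaledFreq (f : ℝ → ℝ) (M : ℝ → ℝ → ℝ → ℝ) (ε δ u : ℝ) : ℝ :=
  √(-f u * (1 + M 0 0 u)) / scaleMu ε δ

/-- The coordinate `x = μ δ^{3/4} x̂`, where `x̂ = F̂^{-1/2} (1 + M(0,0,u))^{1/2} x̂₀` and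
`x̂₀ = √(2 ẑ₀) cos w₀`, as a function of the action-angle variables `(z, w) = (ẑ₀, w₀)`. -/
def coordX (f : ℝ → ℝ) (M : ℝ → ℝ → ℝ → ℝ) (ε δ u z w : ℝ) : ℝ :=
  scaleMu ε δ * δ ^ (3 / 4 : ℝ) *
    (scaledFreq f M ε δ u ^ (-(1 / 2) : ℝ) * (1 + M 0 0 u) ^ (1 / 2 : ℝ) * (√(2 * z) * cos w))

/-- The coordinate `y = μ² δ^{3/4} ŷ`, where `ŷ = F̂^{1/2} (1 + M(0,0,u))^{-1/2} ŷ₀` and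
`ŷ₀ = √(2 ẑ₀) sin w₀`, as a function of the action-angle variables `(z, w) = (ẑ₀, w₀)`. -/
def coordY (f : ℝ → ℝ) (M : ℝ → ℝ → ℝ → ℝ) (ε δ u z w : ℝ) : ℝ :=
  scaleMu ε δ ^ 2 * δ ^ (3 / 4 : ℝ) *
    (scaledFreq f M ε δ u ^ (1 / 2 : ℝ) * (1 + M 0 0 u) ^ (-(1 / 2) : ℝ) * (√(2 * z) * sin w))

/-- The graph of the outer map `P_o`: the solution that has action-angle variables `p` at
`u = -π + τ/2` has action-angle variables `q` at `û = -û_*`, that is at `u = -μ² û_*`. The angle is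
followed continuously along the solution, so it is a real number and not only a class
modulo `2π`. -/
def OuterMap (f : ℝ → ℝ) (M : ℝ → ℝ → ℝ → ℝ) (V : ℝ → ℝ → ℝ) (τ ε δ us : ℝ)
    (p q : ℝ × ℝ) : Prop :=
  ∃ z w : ℝ → ℝ,
    DifferentiableOn ℝ z (Icc (-π + τ / 2) (-(scaleMu ε δ ^ 2 * us))) ∧
    DifferentiableOn ℝ w (Icc (-π + τ / 2) (-(scaleMu ε δ ^ 2 * us))) ∧
    (∀ u ∈ Icc (-π + τ / 2) (-(scaleMu ε δ ^ 2 * us)), 0 < z u) ∧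
    SolvesMotion f M V ε (-π + τ / 2) (-(scaleMu ε δ ^ 2 * us))
      (fun u => coordX f M ε δ u (z u) (w u)) (fun u => coordY f M ε δ u (z u) (w u)) ∧
    (z (-π + τ / 2), w (-π + τ / 2)) = p ∧
    (z (-(scaleMu ε δ ^ 2 * us)), w (-(scaleMu ε δ ^ 2 * us))) = q

/-- The constant `e₃ = ∫₀^{π-τ/2} √(-f(-u) (1 + M(0,0,-u))) du`. -/
def constE₃ (f : ℝ → ℝ) (M : ℝ → ℝ → ℝ → ℝ) (τ : ℝ) : ℝ :=
  ∫ u in (0 : ℝ)..(π - τ / 2), √(-f (-u) * (1 + M 0 0 (-u)))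

end

/-!
In terms of `ε` alone the action-angle coordinates read `x = √(2 ε z κ) cos w` and
`y = √(2 ε z / κ) sin w` with `κ² = (1 + M(0,0,u)) / (-f(u))` (`coordX_eq`, `coordY_eq`), so `δ`
only enters through the end point `u = -η`, `η = μ² û_*`, and `δ^{3/2}` is a multiple of
`ε η^{-3/2}`. The result is therefore a statement about averaging on `[-T, -η]`, `T = π - τ/2`, with
error `O(ε η^{-3/2})`.

In the variables `(log z, w)` the motion is governed by a smooth vector field (`motion_iff`). Let
`Ω` be the frequency of the linearized oscillator. Up to `O(ε (-u)^{-3/2})` the angle has the speed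
`-Ω/ε - z B(u)`, and all other terms of both speeds are products of one of three coefficients of
size `(-u)⁻¹`, a power of `z` and a harmonic of `w` (`exists_speed_bounds`). Each harmonic is, up to
`O(ε (-u)^{-5/2})`, the derivative of a quantity of size `ε (-u)^{-3/2}`, because the angle rotates
with the speed `-Ω/ε` and `Ω` is comparable to `(-u)^{1/2}` (`oscillation_corrector`). Subtracting
these quantities and integrating shows that `z` is conserved and that `w` follows the averaged
equation, both up to `O(ε (-u)^{-3/2})` (`exists_averaging_const`).

Solutions exist up to `u = -η`: the field with `z` cut off at twice the bound of the initial values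
is bounded, and by averaging the cutoff never becomes active (`exists_solution`). They are unique
because the field is smooth (`motion_unique`).

The two integrals that remain are explicit up to small errors. Since
`Ω = (-u)^{1/2} + O((-u)^{3/2})`, the integral of `Ω` is `e₃ - 2/3 η^{3/2} + O(η^{5/2})` (`exists_integral_freq`).
Since `B = 3/2 (-u)⁻¹ + O(1)`, the integral of `B` is `log e₄ - 3/2 log η + O(η)`, which defines `e₄`
(`exists_driftIntegral_sub_le`).
-/

/-! ### Taylor estimates, growth estimates and a continuation principle -/

theorem ContDiffOn.exists_norm_sub_le {E F : Type*} [NormedAddCommGroup E] [NormedSpace ℝ E]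
    [NormedAddCommGroup F] [NormedSpace ℝ F] {h : E → F} {D S : Set E}
    (hh : ContDiffOn ℝ ∞ h D) (hD : UniqueDiffOn ℝ D) (hS : IsCompact S) (hSc : Convex ℝ S)
    (hSD : S ⊆ D) : ∃ C, 0 ≤ C ∧ ∀ x ∈ S, ∀ y ∈ S, ‖h y - h x‖ ≤ C * ‖y - x‖ := by
  have hc : ContinuousOn (fderivWithin ℝ h D) S :=
    (hh.continuousOn_fderivWithin hD (by simp)).mono hSD
  obtain ⟨C, hC⟩ := hS.exists_bound_of_continuousOn hc
  refine ⟨max C 0, le_max_right _ _, fun x hx y hy => ?_⟩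
  refine hSc.norm_image_sub_le_of_norm_hasFDerivWithin_le (𝕜 := ℝ)
    (f' := fderivWithin ℝ h D) (fun p hp => ?_) (fun p hp => ?_) hx hy
  · exact (((hh.differentiableOn (by simp)) p (hSD hp)).hasFDerivWithinAt).mono hSD
  · exact (hC p hp).trans (le_max_left _ _)

theorem ContDiffOn.exists_taylor_le {E F : Type*} [NormedAddCommGroup E] [NormedSpace ℝ E]
    [NormedAddCommGroup F] [NormedSpace ℝ F] {h : E → F} {D S : Set E}
    (hh : ContDiffOn ℝ ∞ h D) (hD : UniqueDiffOn ℝ D) (hS : IsCompact S) (hSc : Convex ℝ S)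
    (hSD : S ⊆ D) : ∃ C, 0 ≤ C ∧ ∀ x ∈ S, ∀ y ∈ S,
      ‖h y - h x - fderivWithin ℝ h D x (y - x)‖ ≤ C * ‖y - x‖ ^ 2 := by
  obtain ⟨C, hC0, hC⟩ := (hh.fderivWithin (m := ∞) hD (by simp)).exists_norm_sub_le hD hS hSc hSD
  refine ⟨C, hC0, fun x hx y hy => ?_⟩
  have hseg : segment ℝ x y ⊆ S := hSc.segment_subset hx hy
  have := (convex_segment x y).norm_image_sub_le_of_norm_hasFDerivWithin_le' (𝕜 := ℝ) (f := h)
    (f' := fderivWithin ℝ h D) (C := C * ‖y - x‖) (φ := fderivWithin ℝ h D x)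
    (fun p hp => (((hh.differentiableOn (by simp)) p (hSD (hseg hp))).hasFDerivWithinAt).mono
      (hseg.trans hSD))
    (fun p hp => ?_) (left_mem_segment ℝ x y) (right_mem_segment ℝ x y)
  · rw [pow_two, ← mul_assoc]; exact this
  · refine (hC x hx p (hseg hp)).trans ?_
    gcongr
    obtain ⟨s, t, hs, ht, hst, rfl⟩ := hp
    have : s • x + t • y - x = t • (y - x) := by
      rw [show s = 1 - t by linarith]; module
    rw [this, norm_smul, Real.norm_of_nonneg ht]
    nlinarith [norm_nonneg (y - x)]

theorem hasDerivAt_inv_sqrt_neg_pow_three {u : ℝ} (hu : u < 0) :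
    HasDerivAt (fun u => 1 / √(-u) ^ 3) (3 / 2 * (1 / √(-u) ^ 5)) u := by
  have hr : 0 < √(-u) := Real.sqrt_pos.2 (by linarith)
  have h1 : HasDerivAt (fun u => √(-u)) (-1 / (2 * √(-u))) u :=
    (hasDerivAt_neg u).sqrt (by linarith)
  refine ((hasDerivAt_const u (1 : ℝ)).div (h1.fun_pow 3) (by positivity)).congr_deriv ?_
  push_cast
  field_simp
  norm_num

/-- A function whose derivative is `O((-u)^{-5/2})` on `[a, b]`, `b < 0`, changes by
`O((-t)^{-3/2})` between `a` and `t`. -/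
theorem abs_sub_le_of_deriv_le {J J' : ℝ → ℝ} {a b A : ℝ} (hb : b < 0) (hA : 0 ≤ A)
    (hJ : ∀ u ∈ Icc a b, HasDerivWithinAt J (J' u) (Icc a b) u)
    (hJ' : ∀ u ∈ Icc a b, |J' u| ≤ A / √(-u) ^ 5) :
    ∀ t ∈ Icc a b, |J t - J a| ≤ A / √(-t) ^ 3 := by
  have hd : ∀ u ∈ Icc a b,
      HasDerivAt (fun u => A / √(-u) ^ 3) (A * (3 / 2 * (1 / √(-u) ^ 5))) u := by
    intro u hu
    have := (hasDerivAt_inv_sqrt_neg_pow_three (u := u) (by linarith [hu.2])).const_mul A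
    simpa [div_eq_mul_inv] using this
  refine image_norm_le_of_norm_deriv_right_le_deriv_boundary' (f := fun t => J t - J a)
    (f' := J') (B := fun u => A / √(-u) ^ 3) (B' := fun u => A * (3 / 2 * (1 / √(-u) ^ 5)))
    ?_ ?_ ?_ ?_ ?_ ?_
  · exact fun u hu => ((hJ u hu).continuousWithinAt).sub continuousWithinAt_const
  · intro u hu
    exact ((hJ u (Ico_subset_Icc_self hu)).mono_of_mem_nhdsWithin
      (Icc_mem_nhdsGE_of_mem hu)).sub_const _
  · simp only [sub_self, norm_zero]; positivity
  · exact fun u hu => (hd u hu).continuousAt.continuousWithinAt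
  · exact fun u hu => (hd u (Ico_subset_Icc_self hu)).hasDerivWithinAt
  · intro u hu
    refine (hJ' u (Ico_subset_Icc_self hu)).trans ?_
    have : 0 ≤ A / √(-u) ^ 5 := by positivity
    have e : A * (3 / 2 * (1 / √(-u) ^ 5)) = 3 / 2 * (A / √(-u) ^ 5) := by ring
    rw [e]; linarith

/-- A continuous function that stays below `B' < B` for as long as it stays below `B` never
reaches `B`. -/
theorem ContinuousOn.le_of_bootstrap {φ : ℝ → ℝ} {a b B' B : ℝ} (hφ : ContinuousOn φ (Icc a b))
    (hB : B' < B) (ha : φ a ≤ B)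
    (h : ∀ t ∈ Icc a b, (∀ u ∈ Icc a t, φ u ≤ B) → φ t ≤ B') : ∀ t ∈ Icc a b, φ t ≤ B := by
  intro t ht
  by_contra! hlt
  have hsub : ∀ u ∈ Icc a b, Icc a u ⊆ Icc a b := fun u hu => Icc_subset_Icc_right hu.2
  have hcl : IsCompact (Icc a b ∩ φ ⁻¹' {B}) :=
    isCompact_Icc.of_isClosed_subset (hφ.preimage_isClosed_of_isClosed isClosed_Icc
      isClosed_singleton) inter_subset_left
  have hivt : ∀ u ∈ Icc a b, B < φ u → ∃ s ∈ Icc a u, φ s = B := fun u hu hBu =>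
    intermediate_value_Icc hu.1 (hφ.mono (hsub u hu)) ⟨ha, hBu.le⟩
  obtain ⟨s₀, hs₀, hs₀B⟩ := hivt t ht hlt
  obtain ⟨s, ⟨hs, hsB⟩, hmin⟩ := hcl.exists_isLeast ⟨s₀, hsub t ht hs₀, hs₀B⟩
  have hle : ∀ u ∈ Icc a s, φ u ≤ B := by
    intro u hu
    by_contra! hBu
    obtain ⟨v, hv, hvB⟩ := hivt u (hsub s hs hu) hBu
    have hsv : s ≤ v := hmin ⟨hsub s hs ⟨hv.1, hv.2.trans hu.2⟩, hvB⟩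
    have : u = s := le_antisymm hu.2 (hsv.trans hv.2)
    rw [this] at hBu
    exact absurd hsB hBu.ne'
  exact absurd hsB ((h s hs hle).trans_lt hB).ne

/-! ### Averaging over a fast angle -/

/-- The constant in `oscillation_corrector`. -/
noncomputable def correctorConst (a A Q D : ℝ) : ℝ :=
  A * Q / a + A * A * Q / a ^ 2 + A * Q / a + A * Q * D / a

/-- Averaging, one harmonic at a time. If the angle rotates with the fast frequency `-Ω/ε`, the
oscillating term `α q Φ'(w)` is, up to `O(ε (-u)^{-5/2})`, minus the derivative of
`ε (α / Ω) q Φ(w)`. -/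
theorem oscillation_corrector {α Ω q w Φ : ℝ → ℝ} {α' Ω' q' w' φ u ε a A Q D : ℝ} {s : Set ℝ}
    (hε : 0 < ε) (hu : u < 0) (ha : 0 < a) (hA : 0 ≤ A) (hQ : 0 ≤ Q)
    (hα : HasDerivWithinAt α α' s u) (hΩ : HasDerivWithinAt Ω Ω' s u)
    (hq : HasDerivWithinAt q q' s u) (hw : HasDerivWithinAt w w' s u)
    (hΦ : HasDerivAt Φ φ (w u))
    (bα : |α u| ≤ A / √(-u) ^ 2) (bα' : |α'| ≤ A / √(-u) ^ 4)
    (bΩ : a * √(-u) ≤ Ω u) (bΩ' : |Ω'| ≤ A / √(-u))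
    (bq : |q u| ≤ Q) (bq' : |q'| ≤ Q / √(-u) ^ 2)
    (bw : |w' + Ω u / ε| ≤ D / √(-u) ^ 2) (bΦ : |Φ (w u)| ≤ 1) (bφ : |φ| ≤ 1) :
    ∃ d, HasDerivWithinAt (fun u => ε * (α u / Ω u * q u * Φ (w u))) d s u ∧
      |d + α u * q u * φ| ≤ correctorConst a A Q D * (ε / √(-u) ^ 5) := by
  have hr : 0 < √(-u) := Real.sqrt_pos.2 (by linarith)
  set r := √(-u) with hr_def
  have hΩ0 : 0 < Ω u := lt_of_lt_of_le (by positivity) bΩ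
  refine ⟨_, ((((hα.div hΩ hΩ0.ne').mul hq).mul (hΦ.comp_hasDerivWithinAt u hw)).const_mul ε), ?_⟩
  have e : ε * (((α' * Ω u - α u * Ω') / Ω u ^ 2 * q u + α u / Ω u * q') * Φ (w u) +
      α u / Ω u * q u * (φ * w')) + α u * q u * φ =
      ε * (α' / Ω u * q u * Φ (w u) - α u * Ω' / Ω u ^ 2 * q u * Φ (w u)
        + α u / Ω u * q' * Φ (w u) + α u / Ω u * q u * (φ * (w' + Ω u / ε))) := by
    field_simp
    ring
  simp only [Pi.mul_apply, Pi.div_apply, Function.comp_def]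
  rw [e, abs_mul, abs_of_pos hε]
  have inv1 : |(Ω u)⁻¹| ≤ (a * r)⁻¹ := by
    rw [abs_of_pos (inv_pos.2 hΩ0)]; exact inv_anti₀ (by positivity) bΩ
  have t1 : |α' / Ω u * q u * Φ (w u)| ≤ A / r ^ 4 * (a * r)⁻¹ * Q * 1 := by
    rw [div_eq_mul_inv, abs_mul, abs_mul, abs_mul]; gcongr
  have t2 : |α u * Ω' / Ω u ^ 2 * q u * Φ (w u)|
      ≤ A / r ^ 2 * (A / r) * ((a * r)⁻¹) ^ 2 * Q * 1 := by
    rw [div_eq_mul_inv, ← inv_pow, abs_mul, abs_mul, abs_mul, abs_mul, abs_pow]; gcongr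
  have t3 : |α u / Ω u * q' * Φ (w u)| ≤ A / r ^ 2 * (a * r)⁻¹ * (Q / r ^ 2) * 1 := by
    rw [div_eq_mul_inv, abs_mul, abs_mul, abs_mul]; gcongr
  have t4 : |α u / Ω u * q u * (φ * (w' + Ω u / ε))|
      ≤ A / r ^ 2 * (a * r)⁻¹ * Q * (1 * (D / r ^ 2)) := by
    rw [div_eq_mul_inv, abs_mul, abs_mul, abs_mul, abs_mul]; gcongr
  have hs := (abs_add_le _ _).trans (add_le_add ((abs_add_le _ _).trans (add_le_add
    ((abs_sub _ _).trans (add_le_add t1 t2)) t3)) t4)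
  calc ε * _ ≤ ε * _ := mul_le_mul_of_nonneg_left hs hε.le
    _ = _ := by unfold correctorConst; field_simp

theorem oscillation_corrector_abs_le {α Ω q φ u ε a A Q : ℝ}
    (hε : 0 < ε) (hu : u < 0) (ha : 0 < a) (hA : 0 ≤ A) (hQ : 0 ≤ Q)
    (bα : |α| ≤ A / √(-u) ^ 2) (bΩ : a * √(-u) ≤ Ω) (bq : |q| ≤ Q) (bφ : |φ| ≤ 1) :
    |ε * (α / Ω * q * φ)| ≤ A * Q / a * (ε / √(-u) ^ 3) := by
  have hr : 0 < √(-u) := Real.sqrt_pos.2 (by linarith)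
  set r := √(-u) with hr_def
  have hΩ0 : 0 < Ω := lt_of_lt_of_le (by positivity) bΩ
  have inv1 : |Ω⁻¹| ≤ (a * r)⁻¹ := by
    rw [abs_of_pos (inv_pos.2 hΩ0)]; exact inv_anti₀ (by positivity) bΩ
  rw [abs_mul, abs_of_pos hε]
  have t1 : |α / Ω * q * φ| ≤ A / r ^ 2 * (a * r)⁻¹ * Q * 1 := by
    rw [div_eq_mul_inv, abs_mul, abs_mul, abs_mul]; gcongr
  calc ε * _ ≤ ε * _ := mul_le_mul_of_nonneg_left t1 hε.le
    _ = _ := by field_simp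

/-- `α` is differentiable on `[-T, 0)` and, together with its derivative, blows up at `0` no
faster than `(-u)⁻¹`. -/
structure SingularCoeff (T A : ℝ) (α : ℝ → ℝ) : Prop where
  hasDerivAt : ∀ u ∈ Ico (-T) 0, HasDerivAt α (deriv α u) u
  abs_le : ∀ u ∈ Ico (-T) 0, |α u| ≤ A / √(-u) ^ 2
  abs_deriv_le : ∀ u ∈ Ico (-T) 0, |deriv α u| ≤ A / √(-u) ^ 4

/-- `Ω` is differentiable on `[-T, 0)` and behaves at `0` like `(-u)^{1/2}`. -/
structure FastFrequency (T a A : ℝ) (Ω : ℝ → ℝ) : Prop where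
  hasDerivAt : ∀ u ∈ Ico (-T) 0, HasDerivAt Ω (deriv Ω u) u
  le : ∀ u ∈ Ico (-T) 0, a * √(-u) ≤ Ω u
  abs_deriv_le : ∀ u ∈ Ico (-T) 0, |deriv Ω u| ≤ A / √(-u)

/-- The equations of motion of `(ζ, w)`, `ζ = log z`, on `[-T, t]`, up to an error
`O(ε (-u)^{-3/2})`: apart from the fast rotation `-Ω/ε` and the drift `-B z` of the angle, all
terms oscillate. -/
structure NearlyAveraged (T A ε t : ℝ) (Ω lam α β B ζ w : ℝ → ℝ) : Prop where
  log_action : ∀ u ∈ Icc (-T) t, ∃ ρ, |ρ| ≤ A * (ε / √(-u) ^ 3) ∧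
    HasDerivWithinAt ζ (-(lam u * cos (2 * w u)) - α u * exp (ζ u) * sin (2 * w u)
      - β u * exp (ζ u) * sin (4 * w u) + ρ) (Icc (-T) t) u
  angle : ∀ u ∈ Icc (-T) t, ∃ ρ, |ρ| ≤ A * (ε / √(-u) ^ 3) ∧
    HasDerivWithinAt w (-(Ω u / ε) + 1 / 2 * (lam u * sin (2 * w u)) - B u * exp (ζ u)
      - α u * exp (ζ u) * cos (2 * w u) - 1 / 2 * (β u * exp (ζ u) * cos (4 * w u)) + ρ)
      (Icc (-T) t) u

theorem abs_mul_mul_le_of_abs_le_one {x y z X Y : ℝ} (hx : |x| ≤ X) (hy : |y| ≤ Y) (hz : |z| ≤ 1) :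
    |x * y * z| ≤ X * Y := by
  rw [abs_mul, abs_mul]
  have h1 := (abs_nonneg x).trans hx
  have h2 := (abs_nonneg y).trans hy
  calc |x| * |y| * |z| ≤ X * Y * 1 := by gcongr
    _ = X * Y := mul_one _

theorem abs_exp_sub_exp_le {x y K : ℝ} (hx : exp x ≤ K) (hy : exp y ≤ K) :
    |exp x - exp y| ≤ K * |x - y| := by
  have key : ∀ x y : ℝ, exp x ≤ K → exp x - exp y ≤ K * |x - y| := by
    intro x y hx
    have h1 := Real.add_one_le_exp (y - x)
    have h2 : exp y = exp x * exp (y - x) := by rw [← Real.exp_add]; congr 1; ring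
    have h3 : exp x - exp y ≤ exp x * (x - y) := by
      rw [h2]; nlinarith [Real.exp_pos x]
    calc _ ≤ _ := h3
      _ ≤ exp x * |x - y| := by gcongr; exact le_abs_self _
      _ ≤ _ := by gcongr
  refine abs_sub_le_iff.2 ⟨key x y hx, ?_⟩
  rw [abs_sub_comm]; exact key y x hy

theorem hasDerivAt_sin_mul_div {k : ℝ} (hk : k ≠ 0) (w : ℝ) :
    HasDerivAt (fun w => sin (k * w) / k) (cos (k * w)) w := by
  have h := ((hasDerivAt_id w).const_mul k).sin.div_const k
  simp only [id, mul_one] at h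
  exact h.congr_deriv (by field_simp)

theorem hasDerivAt_neg_cos_mul_div {k : ℝ} (hk : k ≠ 0) (w : ℝ) :
    HasDerivAt (fun w => -cos (k * w) / k) (sin (k * w)) w := by
  have h := ((hasDerivAt_id w).const_mul k).cos.neg.div_const k
  simp only [id, mul_one] at h
  exact h.congr_deriv (by field_simp)

theorem abs_div_le_one_of_abs_le_one {x k : ℝ} (hk : 1 ≤ k) (hx : |x| ≤ 1) : |x / k| ≤ 1 := by
  rw [abs_div, abs_of_pos (by linarith : (0 : ℝ) < k), div_le_one (by linarith)]
  linarith

/-- Crude bounds for the speed of `log z` and for the deviation of the speed of the angle from the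
fast frequency. -/
theorem NearlyAveraged.exists_hasDerivWithinAt {T A K ε t : ℝ} {Ω lam α β B ζ w : ℝ → ℝ}
    (hA : 0 < A) (hε : 0 < ε) (ht : t < 0)
    (hlam : SingularCoeff T A lam) (hα : SingularCoeff T A α) (hβ : SingularCoeff T A β)
    (hB : SingularCoeff T A B) (h : NearlyAveraged T A ε t Ω lam α β B ζ w)
    (hz : ∀ u ∈ Icc (-T) t, exp (ζ u) ≤ K) (hεt : ε / √(-t) ^ 3 ≤ 1) {u : ℝ}
    (hu : u ∈ Icc (-T) t) :
    ∃ ζ' w', HasDerivWithinAt ζ ζ' (Icc (-T) t) u ∧ HasDerivWithinAt w w' (Icc (-T) t) u ∧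
      |ζ' + lam u * cos (2 * w u) + α u * exp (ζ u) * sin (2 * w u)
        + β u * exp (ζ u) * sin (4 * w u)| ≤ A * T * (ε / √(-u) ^ 5) ∧
      |w' + Ω u / ε - 1 / 2 * (lam u * sin (2 * w u)) + B u * exp (ζ u)
        + α u * exp (ζ u) * cos (2 * w u) + 1 / 2 * (β u * exp (ζ u) * cos (4 * w u))|
          ≤ A * T * (ε / √(-u) ^ 5) ∧
      |ζ'| ≤ A * (1 + 3 * K + T) / √(-u) ^ 2 ∧
      |w' + Ω u / ε| ≤ A * (1 + 3 * K + T) / √(-u) ^ 2 := by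
  have hu0 : u < 0 := hu.2.trans_lt ht
  have huI : u ∈ Ico (-T) 0 := ⟨hu.1, hu0⟩
  have hr : 0 < √(-u) := Real.sqrt_pos.2 (by linarith)
  have hrT : √(-u) ^ 2 ≤ T := by rw [Real.sq_sqrt (by linarith)]; linarith [hu.1]
  have hεu : ε / √(-u) ^ 3 ≤ 1 := by
    refine le_trans ?_ hεt
    have : 0 < √(-t) := Real.sqrt_pos.2 (by linarith)
    have : √(-t) ≤ √(-u) := Real.sqrt_le_sqrt (by linarith [hu.2])
    gcongr
  obtain ⟨ρ, hρ, hζ⟩ := h.log_action u hu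
  obtain ⟨σ, hσ, hw⟩ := h.angle u hu
  set r := √(-u) with hr_def
  have hr5 : ε / r ^ 3 ≤ T * (ε / r ^ 5) := by
    have : ε / r ^ 3 = r ^ 2 * (ε / r ^ 5) := by field_simp
    rw [this]; gcongr
  have hsmall : A * (ε / r ^ 3) ≤ A * T / r ^ 2 := by
    have : A * T / r ^ 2 = A * (T / r ^ 2) := by ring
    rw [this]
    have h1 : 1 ≤ T / r ^ 2 := by rw [le_div_iff₀ (by positivity)]; linarith
    exact mul_le_mul_of_nonneg_left (hεu.trans h1) hA.le
  have hsmall5 : A * (ε / r ^ 3) ≤ A * T * (ε / r ^ 5) := by rw [mul_assoc]; gcongr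
  have hK : 0 ≤ K := (Real.exp_pos _).le.trans (hz u hu)
  have hq : |exp (ζ u)| ≤ K := by rw [abs_of_pos (Real.exp_pos _)]; exact hz u hu
  have hlu := hlam.abs_le u huI
  have hau := hα.abs_le u huI
  have hbu := hβ.abs_le u huI
  have hBu := hB.abs_le u huI
  rw [← hr_def] at hlu hau hbu hBu
  have h1 : |(1 : ℝ)| ≤ 1 := by simp
  have b1 : |lam u * 1 * cos (2 * w u)| ≤ A / r ^ 2 * 1 :=
    abs_mul_mul_le_of_abs_le_one hlu h1 (abs_cos_le_one _)
  have b2 : |lam u * 1 * sin (2 * w u)| ≤ A / r ^ 2 * 1 :=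
    abs_mul_mul_le_of_abs_le_one hlu h1 (abs_sin_le_one _)
  have b3 : |α u * exp (ζ u) * sin (2 * w u)| ≤ A / r ^ 2 * K :=
    abs_mul_mul_le_of_abs_le_one hau hq (abs_sin_le_one _)
  have b4 : |α u * exp (ζ u) * cos (2 * w u)| ≤ A / r ^ 2 * K :=
    abs_mul_mul_le_of_abs_le_one hau hq (abs_cos_le_one _)
  have b5 : |β u * exp (ζ u) * sin (4 * w u)| ≤ A / r ^ 2 * K :=
    abs_mul_mul_le_of_abs_le_one hbu hq (abs_sin_le_one _)
  have b6 : |β u * exp (ζ u) * cos (4 * w u)| ≤ A / r ^ 2 * K :=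
    abs_mul_mul_le_of_abs_le_one hbu hq (abs_cos_le_one _)
  have b7 : |B u * exp (ζ u) * 1| ≤ A / r ^ 2 * K :=
    abs_mul_mul_le_of_abs_le_one hBu hq h1
  have hAr : 0 ≤ A / r ^ 2 := by positivity
  have hArK : 0 ≤ A / r ^ 2 * K := by positivity
  have etot : A * (1 + 3 * K + T) / r ^ 2 = A / r ^ 2 + 3 * (A / r ^ 2 * K) + A * T / r ^ 2 := by
    ring
  rw [mul_one] at b1 b2 b7
  rw [mul_one] at b1 b2
  refine ⟨_, _, hζ, hw, ?_, ?_, ?_, ?_⟩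
  · refine le_trans (le_of_eq ?_) (hρ.trans hsmall5)
    congr 1; ring
  · refine le_trans (le_of_eq ?_) (hσ.trans hsmall5)
    congr 1; ring
  · rw [etot]
    have := hρ.trans hsmall
    rw [abs_le] at *
    constructor <;> linarith [b1.1, b1.2, b3.1, b3.2, b5.1, b5.2]
  · rw [etot]
    have := hσ.trans hsmall
    rw [abs_le] at *
    constructor <;> linarith [b2.1, b2.2, b4.1, b4.2, b6.1, b6.2, b7.1, b7.2]

/-- Along a nearly averaged solution, `log z` is an adiabatic invariant and the angle follows the
averaged equation with `z` frozen at its initial value, both up to `O(ε (-t)^{-3/2})`. -/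
theorem exists_averaging_const {T a A K : ℝ} (hT : 0 < T) (ha : 0 < a) (hA : 0 < A) (hK : 0 < K) :
    ∃ C, 0 < C ∧ ∀ {ε t : ℝ} {Ω lam α β B IΩ IB ζ w : ℝ → ℝ}, 0 < ε → t < 0 → -T ≤ t →
      FastFrequency T a A Ω → SingularCoeff T A lam → SingularCoeff T A α → SingularCoeff T A β →
      SingularCoeff T A B →
      (∀ u ∈ Icc (-T) t, HasDerivWithinAt IΩ (Ω u) (Icc (-T) t) u) →
      (∀ u ∈ Icc (-T) t, HasDerivWithinAt IB (B u) (Icc (-T) t) u) →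
      NearlyAveraged T A ε t Ω lam α β B ζ w →
      (∀ u ∈ Icc (-T) t, exp (ζ u) ≤ K) → ε / √(-t) ^ 3 ≤ 1 →
      |ζ t - ζ (-T)| ≤ C * (ε / √(-t) ^ 3) ∧
      |exp (ζ t) - exp (ζ (-T))| ≤ C * (ε / √(-t) ^ 3) ∧
      |w t - w (-T) + (IΩ t - IΩ (-T)) / ε + exp (ζ (-T)) * (IB t - IB (-T))|
        ≤ C * (ε / √(-t) ^ 3) := by
  set D : ℝ := A * (1 + 3 * K + T) with hD
  have hD0 : 0 < D := by positivity
  set Q : ℝ := 1 + K + K * D with hQ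
  have hQ0 : 0 < Q := by positivity
  set c₀ : ℝ := A * Q / a with hc₀
  set c₁ : ℝ := correctorConst a A Q D with hc₁
  have hc₀0 : 0 < c₀ := by positivity
  have hc₁0 : 0 < c₁ := by rw [hc₁, correctorConst]; positivity
  set C₁ : ℝ := (A * T + 3 * c₁) + 6 * c₀ with hC₁
  have hC₁0 : 0 < C₁ := by positivity
  set C₂ : ℝ := (A * T + 2 * c₁ + A * (K * C₁)) + 4 * c₀ with hC₂
  have hC₂0 : 0 < C₂ := by positivity
  refine ⟨C₁ + K * C₁ + C₂, by positivity, ?_⟩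
  intro ε t Ω lam α β B IΩ IB ζ w hε ht hTt hΩ hlam hα hβ hB hIΩ hIB h hz hεt
  set s : Set ℝ := Icc (-T) t with hs
  have hsub : ∀ u ∈ s, u ∈ Ico (-T) 0 := fun u hu => ⟨hu.1, hu.2.trans_lt ht⟩
  have hleft : -T ∈ s := ⟨le_rfl, hTt⟩
  choose! ζ' w' hζ hw bζ bw bζ' bw' using fun u (hu : u ∈ s) =>
    h.exists_hasDerivWithinAt hA hε ht hlam hα hβ hB hz hεt hu
  -- the amplitudes `1` and `z = exp ζ` of the oscillating terms
  have hq1 : ∀ u ∈ s, HasDerivWithinAt (fun _ : ℝ => (1 : ℝ)) 0 s u ∧ |(1 : ℝ)| ≤ Q ∧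
      |(0 : ℝ)| ≤ Q / √(-u) ^ 2 := fun u _ =>
    ⟨hasDerivWithinAt_const _ _ _, by rw [abs_one, hQ]; nlinarith [mul_pos hK hD0],
      by rw [abs_zero]; positivity⟩
  have hq2 : ∀ u ∈ s, HasDerivWithinAt (fun u => exp (ζ u)) (exp (ζ u) * ζ' u) s u ∧
      |exp (ζ u)| ≤ Q ∧ |exp (ζ u) * ζ' u| ≤ Q / √(-u) ^ 2 := by
    intro u hu
    have h1 : |exp (ζ u)| ≤ K := by rw [abs_of_pos (Real.exp_pos _)]; exact hz u hu
    refine ⟨(hζ u hu).exp, h1.trans (by rw [hQ]; nlinarith [mul_pos hK hD0]), ?_⟩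
    rw [abs_mul]
    calc _ ≤ K * (D / √(-u) ^ 2) := mul_le_mul h1 (bζ' u hu) (abs_nonneg _) hK.le
      _ = K * D / √(-u) ^ 2 := by ring
      _ ≤ Q / √(-u) ^ 2 := by gcongr; rw [hQ]; linarith
  have corr : ∀ {γ q q' Φ φ : ℝ → ℝ}, SingularCoeff T A γ →
      (∀ u ∈ s, HasDerivWithinAt q (q' u) s u ∧ |q u| ≤ Q ∧ |q' u| ≤ Q / √(-u) ^ 2) →
      (∀ x, HasDerivAt Φ (φ x) x) → (∀ x, |Φ x| ≤ 1) → (∀ x, |φ x| ≤ 1) →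
      ∀ u ∈ s, ∃ d, HasDerivWithinAt (fun u => ε * (γ u / Ω u * q u * Φ (w u))) d s u ∧
        |d + γ u * q u * φ (w u)| ≤ c₁ * (ε / √(-u) ^ 5) ∧
        |ε * (γ u / Ω u * q u * Φ (w u))| ≤ c₀ * (ε / √(-u) ^ 3) := by
    intro γ q q' Φ φ hγ hq hΦ bΦ bφ u hu
    have hu' := hsub u hu
    obtain ⟨d, hd, bd⟩ := oscillation_corrector hε hu'.2 ha hA.le hQ0.le
      (hγ.hasDerivAt u hu').hasDerivWithinAt
      (hΩ.hasDerivAt u hu').hasDerivWithinAt (hq u hu).1 (hw u hu) (hΦ _) (hγ.abs_le u hu')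
      (hγ.abs_deriv_le u hu') (hΩ.le u hu') (hΩ.abs_deriv_le u hu') (hq u hu).2.1 (hq u hu).2.2
      (bw' u hu) (bΦ _) (bφ _)
    exact ⟨d, hd, bd, oscillation_corrector_abs_le hε hu'.2 ha hA.le hQ0.le
        (hγ.abs_le u hu') (hΩ.le u hu') (hq u hu).2.1 (bΦ _)⟩
  have hs2 := hasDerivAt_sin_mul_div (k := 2) two_ne_zero
  have hs4 := hasDerivAt_sin_mul_div (k := 4) four_ne_zero
  have hc2 := hasDerivAt_neg_cos_mul_div (k := 2) two_ne_zero
  have hc4 := hasDerivAt_neg_cos_mul_div (k := 4) four_ne_zero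
  have bs : ∀ k : ℝ, 1 ≤ k → ∀ x, |sin (k * x) / k| ≤ 1 := fun k hk x =>
    abs_div_le_one_of_abs_le_one hk (abs_sin_le_one _)
  have bc : ∀ k : ℝ, 1 ≤ k → ∀ x, |-cos (k * x) / k| ≤ 1 := fun k hk x =>
    abs_div_le_one_of_abs_le_one hk (by rw [abs_neg]; exact abs_cos_le_one _)
  choose! d₁ hd₁ bd₁ b₁ using corr hlam hq1 hs2 (bs 2 (by norm_num)) (fun x => abs_cos_le_one _)
  choose! d₂ hd₂ bd₂ b₂ using corr hα hq2 hc2 (bc 2 (by norm_num)) (fun x => abs_sin_le_one _)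
  choose! d₃ hd₃ bd₃ b₃ using corr hβ hq2 hc4 (bc 4 (by norm_num)) (fun x => abs_sin_le_one _)
  choose! d₄ hd₄ bd₄ b₄ using corr hlam hq1 hc2 (bc 2 (by norm_num)) (fun x => abs_sin_le_one _)
  choose! d₅ hd₅ bd₅ b₅ using corr hα hq2 hs2 (bs 2 (by norm_num)) (fun x => abs_cos_le_one _)
  choose! d₆ hd₆ bd₆ b₆ using corr hβ hq2 hs4 (bs 4 (by norm_num)) (fun x => abs_cos_le_one _)
  have mono : ∀ u ∈ s, ∀ v ∈ s, u ≤ v → ε / √(-u) ^ 3 ≤ ε / √(-v) ^ 3 := by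
    intro u hu v hv huv
    have : 0 < √(-v) := Real.sqrt_pos.2 (by linarith [(hsub v hv).2])
    have : √(-v) ≤ √(-u) := Real.sqrt_le_sqrt (by linarith)
    gcongr
  -- `log z` minus its correctors is constant up to `O(ε (-u)^{-3/2})`
  have hlog : ∀ u ∈ s, |ζ u - ζ (-T)| ≤ C₁ * (ε / √(-u) ^ 3) := by
    intro u hu
    have key := abs_sub_le_of_deriv_le (A := (A * T + 3 * c₁) * ε) ht (by positivity)
      (fun u hu => (((hζ u hu).sub (hd₁ u hu)).sub (hd₂ u hu)).sub (hd₃ u hu))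
      (fun u hu => ?_) u hu
    · have m := mono (-T) hleft u hu hu.1
      have m' : c₀ * (ε / √(-(-T)) ^ 3) ≤ c₀ * (ε / √(-u) ^ 3) := by gcongr
      have e : C₁ * (ε / √(-u) ^ 3)
          = (A * T + 3 * c₁) * ε / √(-u) ^ 3 + 6 * (c₀ * (ε / √(-u) ^ 3)) := by
        rw [hC₁]; ring
      rw [e]
      have e1 := abs_le.1 (b₁ u hu)
      have e2 := abs_le.1 (b₂ u hu)
      have e3 := abs_le.1 (b₃ u hu)
      have e4 := abs_le.1 (b₁ _ hleft)
      have e5 := abs_le.1 (b₂ _ hleft)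
      have e6 := abs_le.1 (b₃ _ hleft)
      simp only [Pi.sub_apply] at key
      have e7 := abs_le.1 key
      rw [abs_le]
      constructor <;> linarith [e1.1, e1.2, e2.1, e2.2, e3.1, e3.2, e4.1, e4.2, e5.1, e5.2, e6.1,
        e6.2, e7.1, e7.2]
    · have e : (A * T + 3 * c₁) * ε / √(-u) ^ 5
          = A * T * (ε / √(-u) ^ 5) + 3 * (c₁ * (ε / √(-u) ^ 5)) := by ring
      rw [e]
      have e1 := abs_le.1 (bd₁ u hu)
      have e2 := abs_le.1 (bd₂ u hu)
      have e3 := abs_le.1 (bd₃ u hu)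
      have e4 := abs_le.1 (bζ u hu)
      rw [abs_le]
      constructor <;> linarith [e1.1, e1.2, e2.1, e2.2, e3.1, e3.2, e4.1, e4.2]
  have hexp : ∀ u ∈ s, |exp (ζ u) - exp (ζ (-T))| ≤ K * C₁ * (ε / √(-u) ^ 3) := by
    intro u hu
    refine (abs_exp_sub_exp_le (hz u hu) (hz _ hleft)).trans ?_
    rw [mul_assoc]
    exact mul_le_mul_of_nonneg_left (hlog u hu) hK.le
  -- freezing `z` in the drift costs `|B| |z - z(-T)| = O(ε (-u)^{-5/2})`
  have hang : ∀ u ∈ s, |w u - w (-T) + (IΩ u - IΩ (-T)) / ε + exp (ζ (-T)) * (IB u - IB (-T))|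
      ≤ C₂ * (ε / √(-u) ^ 3) := by
    intro u hu
    have key := abs_sub_le_of_deriv_le (A := (A * T + 2 * c₁ + A * (K * C₁)) * ε) ht
      (by positivity)
      (fun u hu => (((((hw u hu).add ((hd₄ u hu).const_mul (1 / 2))).sub (hd₅ u hu)).sub
        ((hd₆ u hu).const_mul (1 / 2))).add ((hIΩ u hu).div_const ε)).add
        ((hIB u hu).const_mul (exp (ζ (-T)))))
      (fun u hu => ?_) u hu
    · have m := mono (-T) hleft u hu hu.1
      have m' : c₀ * (ε / √(-(-T)) ^ 3) ≤ c₀ * (ε / √(-u) ^ 3) := by gcongr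
      have e : C₂ * (ε / √(-u) ^ 3) = (A * T + 2 * c₁ + A * (K * C₁)) * ε / √(-u) ^ 3
          + 4 * (c₀ * (ε / √(-u) ^ 3)) := by
        rw [hC₂]; ring
      rw [e]
      have e1 := abs_le.1 (b₄ u hu)
      have e2 := abs_le.1 (b₅ u hu)
      have e3 := abs_le.1 (b₆ u hu)
      have e4 := abs_le.1 (b₄ _ hleft)
      have e5 := abs_le.1 (b₅ _ hleft)
      have e6 := abs_le.1 (b₆ _ hleft)
      simp only [Pi.sub_apply, Pi.add_apply] at key
      have e7 := abs_le.1 key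
      rw [sub_div, mul_sub, abs_le]
      constructor <;> linarith [e1.1, e1.2, e2.1, e2.2, e3.1, e3.2, e4.1, e4.2, e5.1, e5.2, e6.1,
        e6.2, e7.1, e7.2]
    · have e : (A * T + 2 * c₁ + A * (K * C₁)) * ε / √(-u) ^ 5
          = A * T * (ε / √(-u) ^ 5) + 2 * (c₁ * (ε / √(-u) ^ 5))
            + A / √(-u) ^ 2 * (K * C₁ * (ε / √(-u) ^ 3)) := by
        have : 0 < √(-u) := Real.sqrt_pos.2 (by linarith [(hsub u hu).2])
        field_simp
      rw [e]
      have e0 : |B u * (exp (ζ u) - exp (ζ (-T)))|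
          ≤ A / √(-u) ^ 2 * (K * C₁ * (ε / √(-u) ^ 3)) := by
        rw [abs_mul]
        exact mul_le_mul (hB.abs_le u (hsub u hu)) (hexp u hu) (abs_nonneg _) (by positivity)
      have e0' := abs_le.1 e0
      have e1 := abs_le.1 (bd₄ u hu)
      have e2 := abs_le.1 (bd₅ u hu)
      have e3 := abs_le.1 (bd₆ u hu)
      have e4 := abs_le.1 (bw u hu)
      rw [abs_le]
      constructor <;> linarith [e1.1, e1.2, e2.1, e2.2, e3.1, e3.2, e4.1, e4.2, e0'.1, e0'.2]
  have htt : t ∈ s := ⟨hTt, le_rfl⟩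
  have hpos : 0 ≤ ε / √(-t) ^ 3 := by positivity
  refine ⟨(hlog t htt).trans ?_, (hexp t htt).trans ?_, (hang t htt).trans ?_⟩ <;>
    refine mul_le_mul_of_nonneg_right ?_ hpos <;> nlinarith [mul_pos hK hC₁0]

/-! ### Coefficients of the linearized and of the quartic problem -/

/-- The domain `a, b ≥ 0` of the perturbation `M a b u`. -/
def quadrant : Set (ℝ × ℝ × ℝ) := Ici 0 ×ˢ (Ici 0 ×ˢ univ)

/-- The domain `a ≥ 0` of the perturbation `V a u`. -/
def halfPlane : Set (ℝ × ℝ) := Ici 0 ×ˢ univ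

/-- The partial derivative `∂M/∂a`, one-sided on the boundary of the quadrant. -/
noncomputable def partialA (M : ℝ → ℝ → ℝ → ℝ) (p : ℝ × ℝ × ℝ) : ℝ :=
  fderivWithin ℝ (fun p : ℝ × ℝ × ℝ => M p.1 p.2.1 p.2.2) quadrant p (1, 0, 0)

/-- The partial derivative `∂M/∂b`, one-sided on the boundary of the quadrant. -/
noncomputable def partialB (M : ℝ → ℝ → ℝ → ℝ) (p : ℝ × ℝ × ℝ) : ℝ :=
  fderivWithin ℝ (fun p : ℝ × ℝ × ℝ => M p.1 p.2.1 p.2.2) quadrant p (0, 1, 0)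

/-- The partial derivative `∂V/∂a`, one-sided at `a = 0`. -/
noncomputable def partialV (V : ℝ → ℝ → ℝ) (p : ℝ × ℝ) : ℝ :=
  fderivWithin ℝ (fun p : ℝ × ℝ => V p.1 p.2) halfPlane p (1, 0)

/-- The coefficient `1 + M(0,0,u)` of the linearized oscillator. -/
def mass (M : ℝ → ℝ → ℝ → ℝ) (u : ℝ) : ℝ := 1 + M 0 0 u

/-- The frequency `√(-f(u) (1 + M(0,0,u)))` of the linearized oscillator. -/
noncomputable def freq (f : ℝ → ℝ) (M : ℝ → ℝ → ℝ → ℝ) (u : ℝ) : ℝ := √(-f u * mass M u)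

/-- The ratio `√((1 + M(0,0,u)) / (-f(u)))` of the semi-axes of the ellipses on which the
linearized oscillator moves. -/
noncomputable def aspect (f : ℝ → ℝ) (M : ℝ → ℝ → ℝ → ℝ) (u : ℝ) : ℝ := √(mass M u / -f u)

/-- The logarithmic derivative of `aspect`. -/
noncomputable def aspectRate (f : ℝ → ℝ) (M : ℝ → ℝ → ℝ → ℝ) (u : ℝ) : ℝ :=
  (1 / 2 * (deriv (mass M) u * -f u / mass M u + deriv f u)) / -f u

/-- The term `x⁴ (1 + V(0,u)) / 2` of the Hamiltonian, which is `2 ε² z² p cos⁴ w` in action-angle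
variables, with `p = quarticX / (-f)`. -/
def quarticX (M : ℝ → ℝ → ℝ → ℝ) (V : ℝ → ℝ → ℝ) (u : ℝ) : ℝ := mass M u * (1 + V 0 u)

/-- The term `y⁴ ∂M/∂b(0,0,u) / 2` of the Hamiltonian, which is `2 ε² z² n sin⁴ w` in action-angle
variables, with `n = quarticY / (-f)`. -/
noncomputable def quarticY (f : ℝ → ℝ) (M : ℝ → ℝ → ℝ → ℝ) (u : ℝ) : ℝ :=
  f u ^ 2 * partialB M (0, 0, u) / mass M u

/-- The term `x² y² ∂M/∂a(0,0,u) / 2` of the Hamiltonian, which is `2 ε² z² q cos² w sin² w` in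
action-angle variables, with `q = quarticXY / (-f)`. -/
noncomputable def quarticXY (f : ℝ → ℝ) (M : ℝ → ℝ → ℝ → ℝ) (u : ℝ) : ℝ :=
  -f u * partialA M (0, 0, u)

/-- The coefficient of the second harmonic of the quartic terms. -/
noncomputable def harmonicTwo (f : ℝ → ℝ) (M : ℝ → ℝ → ℝ → ℝ) (V : ℝ → ℝ → ℝ) (u : ℝ) : ℝ :=
  (2 * (quarticX M V u - quarticY f M u)) / -f u

/-- The coefficient of the fourth harmonic of the quartic terms. -/
noncomputable def harmonicFour (f : ℝ → ℝ) (M : ℝ → ℝ → ℝ → ℝ) (V : ℝ → ℝ → ℝ) (u : ℝ) : ℝ :=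
  (quarticX M V u + quarticY f M u - quarticXY f M u) / -f u

/-- The amplitude dependence of the averaged frequency: the angle drifts at the rate `-z B(u)`. -/
noncomputable def drift (f : ℝ → ℝ) (M : ℝ → ℝ → ℝ → ℝ) (V : ℝ → ℝ → ℝ) (u : ℝ) : ℝ :=
  (3 / 2 * quarticX M V u + 3 / 2 * quarticY f M u + 1 / 2 * quarticXY f M u) / -f u

theorem uniqueDiffOn_quadrant : UniqueDiffOn ℝ quadrant :=
  (uniqueDiffOn_Ici 0).prod ((uniqueDiffOn_Ici 0).prod uniqueDiffOn_univ)

theorem uniqueDiffOn_halfPlane : UniqueDiffOn ℝ halfPlane :=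
  (uniqueDiffOn_Ici 0).prod uniqueDiffOn_univ

theorem ContDiff.deriv_infty {g : ℝ → ℝ} (hg : ContDiff ℝ ∞ g) : ContDiff ℝ ∞ (deriv g) :=
  (contDiff_infty_iff_deriv.1 hg).2

theorem Continuous.exists_abs_le {g : ℝ → ℝ} (hg : Continuous g) (a b : ℝ) :
    ∃ C, 0 < C ∧ ∀ u ∈ Icc a b, |g u| ≤ C := by
  obtain ⟨C, hC⟩ := isCompact_Icc.exists_bound_of_continuousOn (hg.continuousOn (s := Icc a b))
  exact ⟨max C 1, by positivity, fun u hu => (hC u hu).trans (le_max_left _ _)⟩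

namespace IsSlowFastSystem

variable {f : ℝ → ℝ} {M : ℝ → ℝ → ℝ → ℝ} {V : ℝ → ℝ → ℝ} {τ : ℝ}

theorem contDiffOn_partialA (h : IsSlowFastSystem f M V τ) :
    ContDiffOn ℝ ∞ (partialA M) quadrant :=
  (h.smooth_M.fderivWithin (m := ∞) uniqueDiffOn_quadrant (by simp)).clm_apply contDiffOn_const

theorem contDiffOn_partialB (h : IsSlowFastSystem f M V τ) :
    ContDiffOn ℝ ∞ (partialB M) quadrant :=
  (h.smooth_M.fderivWithin (m := ∞) uniqueDiffOn_quadrant (by simp)).clm_apply contDiffOn_const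

theorem contDiffOn_partialV (h : IsSlowFastSystem f M V τ) :
    ContDiffOn ℝ ∞ (partialV V) halfPlane :=
  (h.smooth_V.fderivWithin (m := ∞) uniqueDiffOn_halfPlane (by simp)).clm_apply contDiffOn_const

theorem mass_pos (h : IsSlowFastSystem f M V τ) (u : ℝ) : 0 < mass M u :=
  h.one_add_M_pos 0 0 u le_rfl le_rfl

theorem contDiff_mass (h : IsSlowFastSystem f M V τ) : ContDiff ℝ ∞ (mass M) :=
  contDiff_const.add (h.smooth_M.comp_contDiff (f := fun u : ℝ => ((0 : ℝ), (0 : ℝ), u))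
    (by fun_prop) (fun u => by simp))

theorem contDiff_V_zero (h : IsSlowFastSystem f M V τ) : ContDiff ℝ ∞ (V 0) :=
  h.smooth_V.comp_contDiff (f := fun u : ℝ => ((0 : ℝ), u)) (by fun_prop) (fun u => by simp)

theorem contDiff_partialA_zero (h : IsSlowFastSystem f M V τ) :
    ContDiff ℝ ∞ (fun u => partialA M (0, 0, u)) :=
  h.contDiffOn_partialA.comp_contDiff (f := fun u : ℝ => ((0 : ℝ), (0 : ℝ), u))
    (by fun_prop) (fun u => by simp [quadrant])

theorem contDiff_partialB_zero (h : IsSlowFastSystem f M V τ) :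
    ContDiff ℝ ∞ (fun u => partialB M (0, 0, u)) :=
  h.contDiffOn_partialB.comp_contDiff (f := fun u : ℝ => ((0 : ℝ), (0 : ℝ), u))
    (by fun_prop) (fun u => by simp [quadrant])

theorem contDiff_quarticX (h : IsSlowFastSystem f M V τ) : ContDiff ℝ ∞ (quarticX M V) :=
  h.contDiff_mass.mul (contDiff_const.add h.contDiff_V_zero)

theorem contDiff_quarticY (h : IsSlowFastSystem f M V τ) : ContDiff ℝ ∞ (quarticY f M) :=
  ((h.smooth_f.pow 2).mul h.contDiff_partialB_zero).div h.contDiff_mass fun u => (h.mass_pos u).ne'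

theorem contDiff_quarticXY (h : IsSlowFastSystem f M V τ) : ContDiff ℝ ∞ (quarticXY f M) :=
  h.smooth_f.neg.mul h.contDiff_partialA_zero

theorem f_neg_of_mem (h : IsSlowFastSystem f M V τ) {u : ℝ} (hu : u ∈ Ioo (τ - 2 * π) 0) :
    f u < 0 := by
  rw [← h.periodic_f u]
  exact h.f_neg _ ⟨by linarith [hu.1], by linarith [hu.2]⟩

/-- `-f(u)` is comparable to `-u`: it has a simple zero at `0`. -/
theorem exists_mul_le_neg_f (h : IsSlowFastSystem f M V τ) :
    ∃ c, 0 < c ∧ ∀ u ∈ Icc (-(π - τ / 2)) 0, c * -u ≤ -f u := by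
  have hdf : Differentiable ℝ f := h.smooth_f.differentiable (by simp)
  have hc : ContinuousOn (dslope f 0) univ :=
    (continuousOn_dslope Filter.univ_mem).2 ⟨hdf.continuous.continuousOn, hdf 0⟩
  have hval : ∀ u, f u = u * dslope f 0 u := fun u => by
    have := sub_smul_dslope f 0 u
    simpa [h.f_zero] using this.symm
  have hτ := h.tau_lt
  have hpos : ∀ u ∈ Icc (-(π - τ / 2)) 0, 0 < dslope f 0 u := by
    intro u hu
    rcases hu.2.eq_or_lt with h0 | h0
    · rw [h0, dslope_same, h.deriv_f_zero]; exact one_pos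
    · have := h.f_neg_of_mem (u := u) ⟨by linarith [hu.1], h0⟩
      rw [hval u] at this
      exact pos_of_mul_neg_right this h0.le
  have hne : (Icc (-(π - τ / 2)) (0 : ℝ)).Nonempty := ⟨0, by linarith, le_rfl⟩
  obtain ⟨v, hv, hmin⟩ := isCompact_Icc.exists_isMinOn hne (hc.mono (subset_univ _))
  refine ⟨dslope f 0 v, hpos v hv, fun u hu => ?_⟩
  rw [hval u]
  nlinarith [hmin hu, hu.2, mul_nonneg (neg_nonneg.2 hu.2) (sub_nonneg.2 (hmin hu))]

theorem exists_mass_bounds (h : IsSlowFastSystem f M V τ) :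
    ∃ c, 0 < c ∧ ∀ u ∈ Icc (-(π - τ / 2)) 0, c ≤ mass M u := by
  have hne : (Icc (-(π - τ / 2)) (0 : ℝ)).Nonempty := ⟨0, by linarith [h.tau_lt], le_rfl⟩
  obtain ⟨v, hv, hmin⟩ := isCompact_Icc.exists_isMinOn hne
    h.contDiff_mass.continuous.continuousOn
  exact ⟨mass M v, h.mass_pos v, fun u hu => hmin hu⟩

theorem exists_singularCoeff (h : IsSlowFastSystem f M V τ) {g : ℝ → ℝ} (hg : ContDiff ℝ ∞ g) :
    ∃ A, 0 < A ∧ ∀ A', A ≤ A' → SingularCoeff (π - τ / 2) A' (fun u => g u / -f u) := by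
  obtain ⟨c, hc, hfc⟩ := h.exists_mul_le_neg_f
  obtain ⟨C₁, hC₁, h₁⟩ := hg.continuous.exists_abs_le (-(π - τ / 2)) 0
  obtain ⟨C₂, hC₂, h₂⟩ := hg.deriv_infty.continuous.exists_abs_le (-(π - τ / 2)) 0
  obtain ⟨C₃, hC₃, h₃⟩ := h.smooth_f.deriv_infty.continuous.exists_abs_le (-(π - τ / 2)) 0
  obtain ⟨C₄, hC₄, h₄⟩ := h.smooth_f.continuous.exists_abs_le (-(π - τ / 2)) 0
  refine ⟨C₁ / c + (C₂ * C₄ + C₁ * C₃) / c ^ 2, by positivity, fun A' hA' => ?_⟩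
  have hfpos : ∀ u ∈ Ico (-(π - τ / 2)) 0, 0 < -f u := fun u hu =>
    lt_of_lt_of_le (mul_pos hc (by linarith [hu.2])) (hfc u ⟨hu.1, hu.2.le⟩)
  have hd : ∀ u ∈ Ico (-(π - τ / 2)) 0, HasDerivAt (fun u => g u / -f u)
      ((deriv g u * -f u - g u * -deriv f u) / (-f u) ^ 2) u := fun u hu =>
    ((hg.differentiable (by simp) u).hasDerivAt).div
      ((h.smooth_f.differentiable (by simp) u).hasDerivAt.neg) (hfpos u hu).ne'
  refine ⟨fun u hu => (hd u hu).differentiableAt.hasDerivAt, fun u hu => ?_, fun u hu => ?_⟩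
  · have hu' : u ∈ Icc (-(π - τ / 2)) 0 := ⟨hu.1, hu.2.le⟩
    have hu0 : 0 < -u := by linarith [hu.2]
    rw [Real.sq_sqrt hu0.le, abs_div, abs_of_pos (hfpos u hu)]
    calc |g u| / -f u ≤ C₁ / (c * -u) := by gcongr; exacts [h₁ u hu', hfc u hu']
      _ = C₁ / c / -u := by rw [div_div]
      _ ≤ A' / -u := by
        gcongr; refine le_trans ?_ hA'
        have : 0 ≤ (C₂ * C₄ + C₁ * C₃) / c ^ 2 := by positivity
        linarith
  · have hu' : u ∈ Icc (-(π - τ / 2)) 0 := ⟨hu.1, hu.2.le⟩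
    have hu0 : 0 < -u := by linarith [hu.2]
    have h4 : √(-u) ^ 4 = (-u) ^ 2 := by
      rw [show 4 = 2 * 2 by norm_num, pow_mul, Real.sq_sqrt hu0.le]
    rw [(hd u hu).deriv, h4, abs_div, abs_of_pos (pow_pos (hfpos u hu) 2)]
    have hnum : |deriv g u * -f u - g u * -deriv f u| ≤ C₂ * C₄ + C₁ * C₃ := by
      refine (abs_sub _ _).trans ?_
      rw [abs_mul, abs_mul, abs_neg, abs_neg]
      gcongr
      exacts [h₂ u hu', h₄ u hu', h₁ u hu', h₃ u hu']
    calc _ ≤ (C₂ * C₄ + C₁ * C₃) / (c * -u) ^ 2 := by gcongr; exact hfc u hu'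
      _ = (C₂ * C₄ + C₁ * C₃) / c ^ 2 / (-u) ^ 2 := by rw [mul_pow, div_div]
      _ ≤ A' / (-u) ^ 2 := by
        gcongr; refine le_trans ?_ hA'
        have : 0 ≤ C₁ / c := by positivity
        linarith

theorem exists_fastFrequency (h : IsSlowFastSystem f M V τ) :
    ∃ a A, 0 < a ∧ 0 < A ∧ ∀ A', A ≤ A' → FastFrequency (π - τ / 2) a A' (freq f M) := by
  obtain ⟨c, hc, hfc⟩ := h.exists_mul_le_neg_f
  obtain ⟨d, hd, hmd⟩ := h.exists_mass_bounds
  have hsm : ContDiff ℝ ∞ (fun u => -f u * mass M u) := h.smooth_f.neg.mul h.contDiff_mass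
  obtain ⟨C, hC, hCb⟩ := hsm.deriv_infty.continuous.exists_abs_le (-(π - τ / 2)) 0
  have hlow : ∀ u ∈ Ico (-(π - τ / 2)) 0, c * d * -u ≤ -f u * mass M u := by
    intro u hu
    have hu' : u ∈ Icc (-(π - τ / 2)) 0 := ⟨hu.1, hu.2.le⟩
    have := mul_le_mul (hfc u hu') (hmd u hu') hd.le
      ((mul_nonneg hc.le (by linarith [hu.2])).trans (hfc u hu'))
    linarith
  have hle : ∀ u ∈ Ico (-(π - τ / 2)) 0, √(c * d) * √(-u) ≤ freq f M u := by
    intro u hu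
    rw [← Real.sqrt_mul (by positivity)]
    exact Real.sqrt_le_sqrt (hlow u hu)
  have hder : ∀ u ∈ Ico (-(π - τ / 2)) 0, HasDerivAt (freq f M)
      (deriv (fun u => -f u * mass M u) u / (2 * freq f M u)) u := by
    intro u hu
    have hpos : 0 < -f u * mass M u := lt_of_lt_of_le
      (mul_pos (mul_pos hc hd) (by linarith [hu.2])) (hlow u hu)
    exact (hsm.differentiable (by simp) u).hasDerivAt.sqrt hpos.ne'
  refine ⟨√(c * d), C / (2 * √(c * d)), by positivity, by positivity, fun A' hA' =>
    ⟨fun u hu => (hder u hu).differentiableAt.hasDerivAt, hle, fun u hu => ?_⟩⟩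
  have hr : 0 < √(-u) := Real.sqrt_pos.2 (by linarith [hu.2])
  have hcd : 0 < √(c * d) := by positivity
  have hfr : 0 < freq f M u := lt_of_lt_of_le (by positivity) (hle u hu)
  rw [(hder u hu).deriv, abs_div, abs_of_pos (by positivity : 0 < 2 * freq f M u)]
  calc _ ≤ C / (2 * (√(c * d) * √(-u))) := by
        gcongr
        exacts [hCb u ⟨hu.1, hu.2.le⟩, hle u hu]
    _ = C / (2 * √(c * d)) / √(-u) := by rw [div_div, mul_assoc]
    _ ≤ A' / √(-u) := by gcongr

theorem contDiff_aspectRate_num (h : IsSlowFastSystem f M V τ) :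
    ContDiff ℝ ∞ (fun u => 1 / 2 * (deriv (mass M) u * -f u / mass M u + deriv f u)) :=
  contDiff_const.mul (((h.contDiff_mass.deriv_infty.mul h.smooth_f.neg).div h.contDiff_mass
    fun u => (h.mass_pos u).ne').add h.smooth_f.deriv_infty)

/-- All coefficients of the averaged problem satisfy the bounds that averaging needs. -/
theorem exists_coeff_bounds (h : IsSlowFastSystem f M V τ) :
    ∃ a A, 0 < a ∧ 0 < A ∧ ∀ A', A ≤ A' →
      FastFrequency (π - τ / 2) a A' (freq f M) ∧
      SingularCoeff (π - τ / 2) A' (aspectRate f M) ∧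
      SingularCoeff (π - τ / 2) A' (harmonicTwo f M V) ∧
      SingularCoeff (π - τ / 2) A' (harmonicFour f M V) ∧
      SingularCoeff (π - τ / 2) A' (drift f M V) := by
  obtain ⟨a, A₁, ha, hA₁, h₁⟩ := h.exists_fastFrequency
  obtain ⟨A₂, hA₂, h₂⟩ := h.exists_singularCoeff h.contDiff_aspectRate_num
  have hX := h.contDiff_quarticX
  have hY := h.contDiff_quarticY
  have hXY := h.contDiff_quarticXY
  obtain ⟨A₃, hA₃, h₃⟩ := h.exists_singularCoeff (contDiff_const.mul (hX.sub hY) : ContDiff ℝ ∞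
    (fun u => 2 * (quarticX M V u - quarticY f M u)))
  obtain ⟨A₄, hA₄, h₄⟩ := h.exists_singularCoeff ((hX.add hY).sub hXY)
  obtain ⟨A₅, hA₅, h₅⟩ := h.exists_singularCoeff (((contDiff_const.mul hX).add
    (contDiff_const.mul hY)).add (contDiff_const.mul hXY) : ContDiff ℝ ∞
    (fun u => 3 / 2 * quarticX M V u + 3 / 2 * quarticY f M u + 1 / 2 * quarticXY f M u))
  refine ⟨a, A₁ + A₂ + A₃ + A₄ + A₅, ha, by positivity, fun A' hA' =>
    ⟨h₁ A' ?_, h₂ A' ?_, h₃ A' ?_, h₄ A' ?_, h₅ A' ?_⟩⟩ <;> linarith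

end IsSlowFastSystem

/-! ### The equations of motion in action-angle variables -/

/-- `x²` in action-angle variables. -/
noncomputable def sqX (f : ℝ → ℝ) (M : ℝ → ℝ → ℝ → ℝ) (ε u z w : ℝ) : ℝ :=
  2 * ε * z * aspect f M u * cos w ^ 2

/-- `y²` in action-angle variables. -/
noncomputable def sqY (f : ℝ → ℝ) (M : ℝ → ℝ → ℝ → ℝ) (ε u z w : ℝ) : ℝ :=
  2 * ε * z / aspect f M u * sin w ^ 2

/-- The nonlinear part of the restoring force, divided by `x` and scaled. -/
noncomputable def forceX (f : ℝ → ℝ) (M : ℝ → ℝ → ℝ → ℝ) (V : ℝ → ℝ → ℝ) (ε u z w : ℝ) : ℝ :=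
  aspect f M u / ε * (sqY f M ε u z w * partialA M (sqX f M ε u z w, sqY f M ε u z w, u)
    + 2 * sqX f M ε u z w * (1 + V (sqX f M ε u z w) u)
    + sqX f M ε u z w ^ 2 * partialV V (sqX f M ε u z w, u))

/-- The nonlinear part of the velocity, divided by `y` and scaled. -/
noncomputable def forceY (f : ℝ → ℝ) (M : ℝ → ℝ → ℝ → ℝ) (ε u z w : ℝ) : ℝ :=
  1 / (ε * aspect f M u) * (M (sqX f M ε u z w) (sqY f M ε u z w) u - M 0 0 u
    + sqY f M ε u z w * partialB M (sqX f M ε u z w, sqY f M ε u z w, u))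

/-- The speed of `log z` along the motion. -/
noncomputable def logSpeed (f : ℝ → ℝ) (M : ℝ → ℝ → ℝ → ℝ) (V : ℝ → ℝ → ℝ) (ε u z w : ℝ) : ℝ :=
  -(aspectRate f M u * cos (2 * w)) + sin (2 * w) * (forceY f M ε u z w - forceX f M V ε u z w)

/-- The speed of the angle `w` along the motion. -/
noncomputable def angleSpeed (f : ℝ → ℝ) (M : ℝ → ℝ → ℝ → ℝ) (V : ℝ → ℝ → ℝ) (ε u z w : ℝ) : ℝ :=
  -(freq f M u / ε) + 1 / 2 * (aspectRate f M u * sin (2 * w))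
    - cos w ^ 2 * forceX f M V ε u z w - sin w ^ 2 * forceY f M ε u z w

/-- The equations of motion, solved for the speeds `ℓ` of `log z` and `w'` of the angle. -/
theorem motion_algebra {lam l w' c s F G P κ ε E : ℝ} (hcs : s ^ 2 + c ^ 2 = 1) (hκ : 0 < κ)
    (hε : 0 < ε) (hE : 0 < E) :
    (E * κ * ((lam + l) / 2 * c - w' * s) = ε⁻¹ * (E * s * (F * κ ^ 2 + ε * κ * P)) ∧
      E * ((-lam + l) / 2 * s + w' * c) = -(ε⁻¹ * (E * κ * c * (F + G * (ε / κ))))) ↔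
    (l = -(lam * (c ^ 2 - s ^ 2)) + 2 * s * c * (P - G) ∧
      w' = -(κ * F / ε) + lam * (s * c) - c ^ 2 * G - s ^ 2 * P) := by
  have e1 : E * κ * ((lam + l) / 2 * c - w' * s) = ε⁻¹ * (E * s * (F * κ ^ 2 + ε * κ * P)) ↔
      (lam + l) / 2 * c - w' * s = s * (κ * F / ε + P) := by
    rw [show ε⁻¹ * (E * s * (F * κ ^ 2 + ε * κ * P)) = E * κ * (s * (κ * F / ε + P)) by
      field_simp, mul_right_inj' (by positivity)]
  have e2 : E * ((-lam + l) / 2 * s + w' * c) = -(ε⁻¹ * (E * κ * c * (F + G * (ε / κ)))) ↔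
      (-lam + l) / 2 * s + w' * c = -(c * (κ * F / ε + G)) := by
    rw [show -(ε⁻¹ * (E * κ * c * (F + G * (ε / κ)))) = E * -(c * (κ * F / ε + G)) by
      field_simp, mul_right_inj' (by positivity)]
  rw [e1, e2]
  constructor
  · rintro ⟨h1, h2⟩
    constructor
    · linear_combination 2 * c * h1 + 2 * s * h2 - l * hcs
    · linear_combination (-s) * h1 + c * h2 + (-w' - κ * F / ε) * hcs
  · rintro ⟨rfl, rfl⟩
    constructor
    · linear_combination (-c * lam / 2 + s * P) * hcs
    · linear_combination (s * lam / 2 - c * G) * hcs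

theorem scaleMu_pos {ε δ : ℝ} (hε : 0 < ε) (hδ : 0 < δ) : 0 < scaleMu ε δ :=
  mul_pos (Real.rpow_pos_of_pos hε _) (Real.rpow_pos_of_pos hδ _)

theorem scaleMu_pow_three {ε δ : ℝ} (hε : 0 < ε) (hδ : 0 < δ) :
    scaleMu ε δ ^ 3 * (δ ^ (3 / 4 : ℝ)) ^ 2 = ε := by
  rw [scaleMu, mul_pow, ← Real.rpow_natCast, ← Real.rpow_natCast, ← Real.rpow_natCast,
    ← Real.rpow_mul hε.le, ← Real.rpow_mul hδ.le, ← Real.rpow_mul hδ.le, mul_assoc,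
    ← Real.rpow_add hδ]
  norm_num

namespace IsSlowFastSystem

variable {f : ℝ → ℝ} {M : ℝ → ℝ → ℝ → ℝ} {V : ℝ → ℝ → ℝ} {τ : ℝ}

theorem aspect_pos (h : IsSlowFastSystem f M V τ) {u : ℝ} (hu : f u < 0) : 0 < aspect f M u :=
  Real.sqrt_pos.2 (div_pos (h.mass_pos u) (by linarith))

theorem aspect_sq (h : IsSlowFastSystem f M V τ) {u : ℝ} (hu : f u < 0) :
    aspect f M u ^ 2 = mass M u / -f u :=
  Real.sq_sqrt (div_pos (h.mass_pos u) (by linarith)).le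

theorem freq_eq_aspect_mul (h : IsSlowFastSystem f M V τ) {u : ℝ} (hu : f u < 0) :
    freq f M u = aspect f M u * -f u := by
  have hκ := h.aspect_pos hu
  have hf : 0 < -f u := by linarith
  rw [freq, Real.sqrt_eq_iff_mul_self_eq_of_pos (by positivity)]
  have := h.aspect_sq hu
  rw [eq_div_iff hf.ne'] at this
  linear_combination (-f u) * this

theorem freq_mul_aspect (h : IsSlowFastSystem f M V τ) {u : ℝ} (hu : f u < 0) :
    freq f M u * aspect f M u = mass M u := by
  rw [h.freq_eq_aspect_mul hu]
  have := h.aspect_sq hu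
  rw [eq_div_iff (by linarith)] at this
  linear_combination this

theorem hasDerivAt_aspect (h : IsSlowFastSystem f M V τ) {u : ℝ} (hu : f u < 0) :
    HasDerivAt (aspect f M) (aspect f M u * aspectRate f M u) u := by
  have hκ := h.aspect_pos hu
  have hm := h.mass_pos u
  have hd : HasDerivAt (fun u => mass M u / -f u)
      ((deriv (mass M) u * -f u - mass M u * -deriv f u) / (-f u) ^ 2) u :=
    (h.contDiff_mass.differentiable (by simp) u).hasDerivAt.div
      ((h.smooth_f.differentiable (by simp) u).hasDerivAt.neg) (by linarith)
  refine (hd.sqrt (div_pos hm (by linarith)).ne').congr_deriv ?_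
  change _ / (2 * aspect f M u) = _
  have hsq := h.aspect_sq hu
  have hf : -f u ≠ 0 := by linarith
  rw [div_eq_iff (by positivity), show aspect f M u * aspectRate f M u * (2 * aspect f M u)
    = aspect f M u ^ 2 * (2 * aspectRate f M u) by ring, hsq, aspectRate]
  field_simp
  ring

theorem hasDerivAt_M_sq_left (h : IsSlowFastSystem f M V τ) {b : ℝ} (hb : 0 ≤ b) (u s : ℝ) :
    HasDerivAt (fun s => M (s ^ 2) b u) (2 * s * partialA M (s ^ 2, b, u)) s := by
  have h1 := ((h.smooth_M.differentiableOn (by simp) : DifferentiableOn ℝ _ quadrant) (s ^ 2, b, u)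
    ⟨sq_nonneg s, hb, mem_univ u⟩).hasFDerivWithinAt
  have h2 : HasDerivAt (fun s : ℝ => (s ^ 2, b, u)) (2 * s, 0, 0) s := by
    have := hasDerivAt_pow 2 s
    simp only [Nat.cast_ofNat, Nat.add_one_sub_one, pow_one] at this
    exact this.prodMk (hasDerivAt_const s (b, u))
  have h3 := h1.comp_hasDerivAt s h2
    (Filter.Eventually.of_forall fun x =>
      (⟨sq_nonneg x, hb, mem_univ u⟩ : (x ^ 2, b, u) ∈ quadrant))
  refine h3.congr_deriv ?_
  have : ((2 * s, 0, 0) : ℝ × ℝ × ℝ) = (2 * s) • (1, 0, 0) := by simp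
  rw [this, map_smul, smul_eq_mul]
  rfl

theorem hasDerivAt_M_sq_right (h : IsSlowFastSystem f M V τ) {a : ℝ} (ha : 0 ≤ a) (u s : ℝ) :
    HasDerivAt (fun s => M a (s ^ 2) u) (2 * s * partialB M (a, s ^ 2, u)) s := by
  have h1 := ((h.smooth_M.differentiableOn (by simp) : DifferentiableOn ℝ _ quadrant) (a, s ^ 2, u)
    ⟨ha, sq_nonneg s, mem_univ u⟩).hasFDerivWithinAt
  have h2 : HasDerivAt (fun s : ℝ => (a, s ^ 2, u)) (0, 2 * s, 0) s := by
    have := hasDerivAt_pow 2 s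
    simp only [Nat.cast_ofNat, Nat.add_one_sub_one, pow_one] at this
    exact (hasDerivAt_const s a).prodMk (this.prodMk (hasDerivAt_const s u))
  have h3 := h1.comp_hasDerivAt s h2
    (Filter.Eventually.of_forall fun x =>
      (⟨ha, sq_nonneg x, mem_univ u⟩ : (a, x ^ 2, u) ∈ quadrant))
  refine h3.congr_deriv ?_
  have : ((0, 2 * s, 0) : ℝ × ℝ × ℝ) = (2 * s) • (0, 1, 0) := by simp
  rw [this, map_smul, smul_eq_mul]
  rfl

theorem hasDerivAt_V_sq (h : IsSlowFastSystem f M V τ) (u s : ℝ) :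
    HasDerivAt (fun s => V (s ^ 2) u) (2 * s * partialV V (s ^ 2, u)) s := by
  have h1 := ((h.smooth_V.differentiableOn (by simp) : DifferentiableOn ℝ _ halfPlane) (s ^ 2, u)
    ⟨sq_nonneg s, mem_univ u⟩).hasFDerivWithinAt
  have h2 : HasDerivAt (fun s : ℝ => (s ^ 2, u)) (2 * s, 0) s := by
    have := hasDerivAt_pow 2 s
    simp only [Nat.cast_ofNat, Nat.add_one_sub_one, pow_one] at this
    exact this.prodMk (hasDerivAt_const s u)
  have h3 := h1.comp_hasDerivAt s h2
    (Filter.Eventually.of_forall fun x =>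
      (⟨sq_nonneg x, mem_univ u⟩ : (x ^ 2, u) ∈ halfPlane))
  refine h3.congr_deriv ?_
  have : ((2 * s, 0) : ℝ × ℝ) = (2 * s) • (1, 0) := by simp
  rw [this, map_smul, smul_eq_mul]
  rfl

theorem deriv_hamiltonian_right (h : IsSlowFastSystem f M V τ) (u x y : ℝ) :
    deriv (fun s => hamiltonian f M V u 0 (x ^ 2) (s ^ 2)) y =
      y * (1 + M (x ^ 2) (y ^ 2) u + y ^ 2 * partialB M (x ^ 2, y ^ 2, u)) := by
  have h1 := h.hasDerivAt_M_sq_right (sq_nonneg x) u y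
  have h2 := (((hasDerivAt_pow 2 y).const_mul (1 / 2)).fun_mul (h1.const_add 1)).add_const
    (-(1 / 2 * f u * x ^ 2) + 1 / 2 * (x ^ 2) ^ 2 * (1 + V (x ^ 2) u))
  have h3 : (fun s => hamiltonian f M V u 0 (x ^ 2) (s ^ 2)) =
      fun s => 1 / 2 * s ^ 2 * (1 + M (x ^ 2) (s ^ 2) u)
        + (-(1 / 2 * f u * x ^ 2) + 1 / 2 * (x ^ 2) ^ 2 * (1 + V (x ^ 2) u)) := by
    ext s; rw [hamiltonian]; ring
  rw [h3, h2.deriv]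
  push_cast
  ring

theorem deriv_hamiltonian_left (h : IsSlowFastSystem f M V τ) (u x y : ℝ) :
    deriv (fun s => hamiltonian f M V u 0 (s ^ 2) (y ^ 2)) x =
      x * (-f u + (y ^ 2 * partialA M (x ^ 2, y ^ 2, u) + 2 * x ^ 2 * (1 + V (x ^ 2) u)
        + (x ^ 2) ^ 2 * partialV V (x ^ 2, u))) := by
  have h1 := ((h.hasDerivAt_M_sq_left (sq_nonneg y) u x).const_add 1).const_mul (1 / 2 * y ^ 2)
  have h2 := (hasDerivAt_pow 2 x).const_mul (1 / 2 * f u)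
  have h4 := ((hasDerivAt_pow 4 x).const_mul (1 / 2)).fun_mul ((h.hasDerivAt_V_sq u x).const_add 1)
  have h5 := (h1.fun_sub h2).fun_add h4
  have h3 : (fun s => hamiltonian f M V u 0 (s ^ 2) (y ^ 2)) =
      fun s => 1 / 2 * y ^ 2 * (1 + M (s ^ 2) (y ^ 2) u) - 1 / 2 * f u * s ^ 2
        + 1 / 2 * s ^ 4 * (1 + V (s ^ 2) u) := by
    ext s; rw [hamiltonian]; ring
  rw [h3, h5.deriv]
  push_cast
  ring

/-- In terms of `ε` alone the coordinate `x` is `√(2 ε z κ) cos w`. -/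
theorem coordX_eq (h : IsSlowFastSystem f M V τ) {ε δ u z w : ℝ} (hε : 0 < ε) (hδ : 0 < δ)
    (hu : f u < 0) (hz : 0 ≤ z) :
    coordX f M ε δ u z w = √(2 * ε * z * aspect f M u) * cos w := by
  have hμ := scaleMu_pos hε hδ
  have hκ := h.aspect_pos hu
  have hm := h.mass_pos u
  have hΩ : 0 < freq f M u := by rw [h.freq_eq_aspect_mul hu]; exact mul_pos hκ (by linarith)
  have hsf : scaledFreq f M ε δ u = freq f M u / scaleMu ε δ := rfl
  have hδ' : 0 < δ ^ (3 / 4 : ℝ) := Real.rpow_pos_of_pos hδ _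
  have h1 : scaledFreq f M ε δ u ^ (-(1 / 2) : ℝ) = √(scaleMu ε δ / freq f M u) := by
    rw [hsf, Real.rpow_neg (by positivity), ← Real.sqrt_eq_rpow, ← Real.sqrt_inv, inv_div]
  have h2 : (1 + M 0 0 u) ^ (1 / 2 : ℝ) = √(mass M u) := by rw [← Real.sqrt_eq_rpow]; rfl
  rw [coordX, h1, h2]
  have : √(2 * ε * z * aspect f M u) = scaleMu ε δ * δ ^ (3 / 4 : ℝ) *
      (√(scaleMu ε δ / freq f M u) * √(mass M u) * √(2 * z)) := by
    rw [Real.sqrt_eq_iff_mul_self_eq (by positivity) (by positivity)]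
    have e : ∀ a b c d : ℝ, 0 ≤ b → 0 ≤ c → 0 ≤ d → a * (√b * √c * √d) * (a * (√b * √c * √d))
        = a ^ 2 * (b * c * d) := by
      intro a b c d hb hc hd
      rw [show a * (√b * √c * √d) * (a * (√b * √c * √d)) =
        a ^ 2 * ((√b * √b) * (√c * √c) * (√d * √d)) by ring, Real.mul_self_sqrt hb,
        Real.mul_self_sqrt hc, Real.mul_self_sqrt hd]
    rw [e _ _ _ _ (by positivity) hm.le (by positivity), ← h.freq_mul_aspect hu]
    have e1 : scaleMu ε δ / freq f M u * (freq f M u * aspect f M u) =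
        scaleMu ε δ * aspect f M u := by field_simp
    rw [e1]
    linear_combination (-(2 * z * aspect f M u)) * scaleMu_pow_three hε hδ
  rw [this]; ring

/-- In terms of `ε` alone the coordinate `y` is `√(2 ε z / κ) sin w`. -/
theorem coordY_eq (h : IsSlowFastSystem f M V τ) {ε δ u z w : ℝ} (hε : 0 < ε) (hδ : 0 < δ)
    (hu : f u < 0) (hz : 0 ≤ z) :
    coordY f M ε δ u z w = √(2 * ε * z / aspect f M u) * sin w := by
  have hμ := scaleMu_pos hε hδ
  have hκ := h.aspect_pos hu
  have hm := h.mass_pos u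
  have hΩ : 0 < freq f M u := by rw [h.freq_eq_aspect_mul hu]; exact mul_pos hκ (by linarith)
  have hsf : scaledFreq f M ε δ u = freq f M u / scaleMu ε δ := rfl
  have hδ' : 0 < δ ^ (3 / 4 : ℝ) := Real.rpow_pos_of_pos hδ _
  have h1 : scaledFreq f M ε δ u ^ (1 / 2 : ℝ) = √(freq f M u / scaleMu ε δ) := by
    rw [hsf, ← Real.sqrt_eq_rpow]
  have h2 : (1 + M 0 0 u) ^ (-(1 / 2) : ℝ) = √((mass M u)⁻¹) := by
    change mass M u ^ (-(1 / 2) : ℝ) = _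
    rw [Real.rpow_neg hm.le, ← Real.sqrt_eq_rpow, ← Real.sqrt_inv]
  rw [coordY, h1, h2]
  have : √(2 * ε * z / aspect f M u) = scaleMu ε δ ^ 2 * δ ^ (3 / 4 : ℝ) *
      (√(freq f M u / scaleMu ε δ) * √((mass M u)⁻¹) * √(2 * z)) := by
    rw [Real.sqrt_eq_iff_mul_self_eq (by positivity) (by positivity)]
    have e : ∀ a b c d : ℝ, 0 ≤ b → 0 ≤ c → 0 ≤ d → a * (√b * √c * √d) * (a * (√b * √c * √d))
        = a ^ 2 * (b * c * d) := by
      intro a b c d hb hc hd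
      rw [show a * (√b * √c * √d) * (a * (√b * √c * √d)) =
        a ^ 2 * ((√b * √b) * (√c * √c) * (√d * √d)) by ring, Real.mul_self_sqrt hb,
        Real.mul_self_sqrt hc, Real.mul_self_sqrt hd]
    rw [e _ _ _ _ (by positivity) (by positivity) (by positivity), ← h.freq_mul_aspect hu]
    have e1 : freq f M u / scaleMu ε δ * (freq f M u * aspect f M u)⁻¹ =
        1 / (scaleMu ε δ * aspect f M u) := by field_simp
    rw [e1]
    have e2 := scaleMu_pow_three hε hδ
    field_simp
    linear_combination (-z) * e2
  rw [this]; ring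

/-- The equations of motion in action-angle variables. -/
theorem motion_iff (h : IsSlowFastSystem f M V τ) {ε δ a b : ℝ} (hε : 0 < ε) (hδ : 0 < δ)
    (hab : a < b) (hf : ∀ u ∈ Icc a b, f u < 0) {z w : ℝ → ℝ} {l w' u : ℝ}
    (hz : ∀ u ∈ Icc a b, 0 < z u) (hu : u ∈ Icc a b)
    (hdz : HasDerivWithinAt z (z u * l) (Icc a b) u) (hdw : HasDerivWithinAt w w' (Icc a b) u) :
    (HasDerivWithinAt (fun u => coordX f M ε δ u (z u) (w u))
      (ε⁻¹ * deriv (fun s => hamiltonian f M V u 0 (coordX f M ε δ u (z u) (w u) ^ 2) (s ^ 2))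
        (coordY f M ε δ u (z u) (w u))) (Icc a b) u ∧
    HasDerivWithinAt (fun u => coordY f M ε δ u (z u) (w u))
      (-(ε⁻¹ * deriv (fun s => hamiltonian f M V u 0 (s ^ 2) (coordY f M ε δ u (z u) (w u) ^ 2))
        (coordX f M ε δ u (z u) (w u)))) (Icc a b) u) ↔
    (l = logSpeed f M V ε u (z u) (w u) ∧ w' = angleSpeed f M V ε u (z u) (w u)) := by
  have hud : UniqueDiffWithinAt ℝ (Icc a b) u := uniqueDiffOn_Icc hab u hu
  have hκ := h.aspect_pos (hf u hu)
  have hzu := hz u hu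
  have hdκ := (h.hasDerivAt_aspect (hf u hu)).hasDerivWithinAt (s := Icc a b)
  set κ := aspect f M u with hκd
  have hE0 : 0 < 2 * ε * z u / κ := by positivity
  set E := √(2 * ε * z u / κ) with hE
  have hEpos : 0 < E := Real.sqrt_pos.2 hE0
  have hEsq : E ^ 2 = 2 * ε * z u / κ := Real.sq_sqrt hE0.le
  have hEκ : √(2 * ε * z u * κ) = E * κ := by
    rw [Real.sqrt_eq_iff_mul_self_eq_of_pos (by positivity)]
    have : E * κ * (E * κ) = E ^ 2 * κ ^ 2 := by ring
    rw [this, hEsq]; field_simp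
  have hX : HasDerivWithinAt (fun u => coordX f M ε δ u (z u) (w u))
      (E * κ * ((aspectRate f M u + l) / 2 * cos (w u) - w' * sin (w u))) (Icc a b) u := by
    have h1 : HasDerivWithinAt (fun u => √(2 * ε * z u * aspect f M u) * cos (w u))
        (E * κ * ((aspectRate f M u + l) / 2 * cos (w u) - w' * sin (w u))) (Icc a b) u := by
      refine ((((hdz.const_mul (2 * ε)).fun_mul hdκ).sqrt (by positivity)).fun_mul
        hdw.cos).congr_deriv ?_
      rw [← hκd, hEκ]
      have e : (2 * ε * (z u * l) * κ + 2 * ε * z u * (κ * aspectRate f M u)) / (2 * (E * κ))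
          = E * κ * ((aspectRate f M u + l) / 2) := by
        rw [div_eq_iff (by positivity), show E * κ * ((aspectRate f M u + l) / 2) * (2 * (E * κ))
          = E ^ 2 * κ ^ 2 * (aspectRate f M u + l) by ring, hEsq]
        field_simp
        ring
      rw [e]; ring
    exact h1.congr (fun v hv => h.coordX_eq hε hδ (hf v hv) (hz v hv).le)
      (h.coordX_eq hε hδ (hf u hu) hzu.le)
  have hY : HasDerivWithinAt (fun u => coordY f M ε δ u (z u) (w u))
      (E * ((-aspectRate f M u + l) / 2 * sin (w u) + w' * cos (w u))) (Icc a b) u := by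
    have h1 : HasDerivWithinAt (fun u => √(2 * ε * z u / aspect f M u) * sin (w u))
        (E * ((-aspectRate f M u + l) / 2 * sin (w u) + w' * cos (w u))) (Icc a b) u := by
      refine ((((hdz.const_mul (2 * ε)).fun_div hdκ hκ.ne').sqrt hE0.ne').fun_mul
        hdw.sin).congr_deriv ?_
      rw [← hκd, ← hE]
      have e : (2 * ε * (z u * l) * κ - 2 * ε * z u * (κ * aspectRate f M u)) / κ ^ 2 / (2 * E)
          = E * ((-aspectRate f M u + l) / 2) := by
        rw [div_eq_iff (by positivity), show E * ((-aspectRate f M u + l) / 2) * (2 * E)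
          = E ^ 2 * (-aspectRate f M u + l) by ring, hEsq]
        field_simp
        ring
      rw [e]; ring
    exact h1.congr (fun v hv => h.coordY_eq hε hδ (hf v hv) (hz v hv).le)
      (h.coordY_eq hε hδ (hf u hu) hzu.le)
  have hx : coordX f M ε δ u (z u) (w u) = E * κ * cos (w u) := by
    rw [h.coordX_eq hε hδ (hf u hu) hzu.le, ← hκd, hEκ]
  have hy : coordY f M ε δ u (z u) (w u) = E * sin (w u) := by
    rw [h.coordY_eq hε hδ (hf u hu) hzu.le]
  have hxx : (E * κ * cos (w u)) ^ 2 = sqX f M ε u (z u) (w u) := by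
    rw [sqX, ← hκd, mul_pow, mul_pow, hEsq]; field_simp
  have hyy : (E * sin (w u)) ^ 2 = sqY f M ε u (z u) (w u) := by
    rw [sqY, ← hκd, mul_pow, hEsq]
  have hmass : mass M u = -f u * κ ^ 2 := by
    rw [← h.freq_mul_aspect (hf u hu), h.freq_eq_aspect_mul (hf u hu)]; ring
  have iffX : ∀ r, HasDerivWithinAt (fun u => coordX f M ε δ u (z u) (w u)) r (Icc a b) u ↔
      E * κ * ((aspectRate f M u + l) / 2 * cos (w u) - w' * sin (w u)) = r := fun r =>
    ⟨fun hr => hud.eq_deriv _ hX hr, fun hr => hr ▸ hX⟩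
  have iffY : ∀ r, HasDerivWithinAt (fun u => coordY f M ε δ u (z u) (w u)) r (Icc a b) u ↔
      E * ((-aspectRate f M u + l) / 2 * sin (w u) + w' * cos (w u)) = r := fun r =>
    ⟨fun hr => hud.eq_deriv _ hY hr, fun hr => hr ▸ hY⟩
  rw [iffX, iffY, h.deriv_hamiltonian_right, h.deriv_hamiltonian_left, hx, hy, hxx, hyy]
  have eP : 1 + M (sqX f M ε u (z u) (w u)) (sqY f M ε u (z u) (w u)) u
      + sqY f M ε u (z u) (w u)
        * partialB M (sqX f M ε u (z u) (w u), sqY f M ε u (z u) (w u), u)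
      = -f u * κ ^ 2 + ε * κ * forceY f M ε u (z u) (w u) := by
    rw [← hmass, forceY, ← hκd, mass]; field_simp; ring
  have eG : sqY f M ε u (z u) (w u)
        * partialA M (sqX f M ε u (z u) (w u), sqY f M ε u (z u) (w u), u)
      + 2 * sqX f M ε u (z u) (w u) * (1 + V (sqX f M ε u (z u) (w u)) u)
      + sqX f M ε u (z u) (w u) ^ 2 * partialV V (sqX f M ε u (z u) (w u), u)
      = forceX f M V ε u (z u) (w u) * (ε / κ) := by
    rw [forceX, ← hκd]; field_simp
  rw [eP, eG, motion_algebra (sin_sq_add_cos_sq _) hκ hε hEpos, logSpeed, angleSpeed,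
    h.freq_eq_aspect_mul (hf u hu), ← hκd, sin_two_mul, cos_two_mul']
  have e3 : 1 / 2 * (aspectRate f M u * (2 * sin (w u) * cos (w u)))
    = aspectRate f M u * (sin (w u) * cos (w u)) := by ring
  rw [e3]

end IsSlowFastSystem

/-! ### The averaging normal form -/

theorem quarticXY_div {f : ℝ → ℝ} {M : ℝ → ℝ → ℝ → ℝ} {u : ℝ} (hu : f u < 0) :
    quarticXY f M u / -f u = partialA M (0, 0, u) := by
  have hf : f u ≠ 0 := hu.ne
  rw [quarticXY]; field_simp

/-- The harmonics of the speed of `log z` produced by the quartic terms `p`, `n`, `q`. -/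
theorem logSpeed_main {lam p n q z w : ℝ} :
    -(lam * cos (2 * w)) + sin (2 * w) * (2 * z * (cos w ^ 2 * q + 2 * sin w ^ 2 * n)
      - 2 * z * (sin w ^ 2 * q + 2 * cos w ^ 2 * p)) =
    -(lam * cos (2 * w)) - 2 * (p - n) * z * sin (2 * w) - (p + n - q) * z * sin (4 * w) := by
  have h4 : sin (4 * w) = 2 * sin (2 * w) * cos (2 * w) := by rw [← sin_two_mul]; ring_nf
  rw [h4, cos_two_mul']
  linear_combination (2 * z * sin (2 * w) * (n - p)) * sin_sq_add_cos_sq w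

/-- The mean value and the harmonics of the speed of `w` produced by the quartic terms. -/
theorem angleSpeed_main {z p n q w : ℝ} :
    cos w ^ 2 * (2 * z * (sin w ^ 2 * q + 2 * cos w ^ 2 * p))
      + sin w ^ 2 * (2 * z * (cos w ^ 2 * q + 2 * sin w ^ 2 * n)) =
    (3 / 2 * p + 3 / 2 * n + 1 / 2 * q) * z + 2 * (p - n) * z * cos (2 * w)
      + 1 / 2 * ((p + n - q) * z * cos (4 * w)) := by
  have h4 : cos (4 * w) = 2 * cos (2 * w) ^ 2 - 1 := by rw [← cos_two_mul]; ring_nf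
  have hs : sin w ^ 2 = 1 - cos w ^ 2 := sin_sq w
  rw [h4, cos_two_mul, hs]
  ring

namespace IsSlowFastSystem

variable {f : ℝ → ℝ} {M : ℝ → ℝ → ℝ → ℝ} {V : ℝ → ℝ → ℝ} {τ : ℝ}

theorem f_neg_of_mem_Ico (h : IsSlowFastSystem f M V τ) {u : ℝ} (hu : u ∈ Ico (-(π - τ / 2)) 0) :
    f u < 0 :=
  h.f_neg_of_mem ⟨by linarith [hu.1, h.tau_lt], hu.2⟩

theorem exists_aspect_bounds (h : IsSlowFastSystem f M V τ) :
    ∃ C, 0 < C ∧ ∀ u ∈ Ico (-(π - τ / 2)) 0,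
      aspect f M u ≤ C / √(-u) ∧ 1 / aspect f M u ≤ C / √(-u) := by
  obtain ⟨a, A, ha, hA, hfr⟩ := h.exists_fastFrequency
  obtain ⟨C₁, hC₁, h₁⟩ := h.contDiff_mass.continuous.exists_abs_le (-(π - τ / 2)) 0
  obtain ⟨C₂, hC₂, h₂⟩ := h.smooth_f.continuous.exists_abs_le (-(π - τ / 2)) 0
  refine ⟨C₁ / a + C₂ / a, by positivity, fun u hu => ?_⟩
  have hf := h.f_neg_of_mem_Ico hu
  have hκ := h.aspect_pos hf
  have hr : 0 < √(-u) := Real.sqrt_pos.2 (by linarith [hu.2])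
  have hΩ := (hfr A le_rfl).le u hu
  have hΩ0 : 0 < freq f M u := lt_of_lt_of_le (by positivity) hΩ
  have e1 : aspect f M u = mass M u / freq f M u := by
    rw [← h.freq_mul_aspect hf]; field_simp
  have e2 : 1 / aspect f M u = -f u / freq f M u := by
    rw [h.freq_eq_aspect_mul hf]
    have : f u ≠ 0 := hf.ne
    field_simp
  have hm := (le_abs_self _).trans (h₁ u ⟨hu.1, hu.2.le⟩)
  have hf' := (neg_le_abs _).trans (h₂ u ⟨hu.1, hu.2.le⟩)
  have p1 : 0 ≤ C₁ / a / √(-u) := by positivity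
  have p2 : 0 ≤ C₂ / a / √(-u) := by positivity
  rw [add_div]
  constructor
  · rw [e1]
    calc _ ≤ C₁ / (a * √(-u)) := by gcongr
      _ = C₁ / a / √(-u) := by rw [div_div]
      _ ≤ _ := by linarith
  · rw [e2]
    calc _ ≤ C₂ / (a * √(-u)) := by gcongr
      _ = C₂ / a / √(-u) := by rw [div_div]
      _ ≤ _ := by linarith

/-- Taylor estimates for the perturbations at `a = b = 0`, uniform in `u`. -/
theorem exists_taylor_bounds (h : IsSlowFastSystem f M V τ) :
    ∃ L, 0 < L ∧ ∀ u ∈ Icc (-(π - τ / 2)) 0, ∀ a ∈ Icc (0 : ℝ) 1, ∀ b ∈ Icc (0 : ℝ) 1,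
      |M a b u - M 0 0 u - (a * partialA M (0, 0, u) + b * partialB M (0, 0, u))|
        ≤ L * (a + b) ^ 2 ∧
      |partialA M (a, b, u) - partialA M (0, 0, u)| ≤ L * (a + b) ∧
      |partialB M (a, b, u) - partialB M (0, 0, u)| ≤ L * (a + b) ∧
      |V a u - V 0 u| ≤ L * a ∧ |partialV V (a, u)| ≤ L := by
  set I := Icc (-(π - τ / 2)) (0 : ℝ) with hI
  have hS : IsCompact (Icc (0 : ℝ) 1 ×ˢ (Icc (0 : ℝ) 1 ×ˢ I)) :=
    isCompact_Icc.prod (isCompact_Icc.prod isCompact_Icc)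
  have hSc : Convex ℝ (Icc (0 : ℝ) 1 ×ˢ (Icc (0 : ℝ) 1 ×ˢ I)) :=
    (convex_Icc 0 1).prod ((convex_Icc 0 1).prod (convex_Icc _ _))
  have hSD : Icc (0 : ℝ) 1 ×ˢ (Icc (0 : ℝ) 1 ×ˢ I) ⊆ quadrant :=
    prod_mono Icc_subset_Ici_self (prod_mono Icc_subset_Ici_self (subset_univ _))
  have hS' : IsCompact (Icc (0 : ℝ) 1 ×ˢ I) := isCompact_Icc.prod isCompact_Icc
  have hSc' : Convex ℝ (Icc (0 : ℝ) 1 ×ˢ I) := (convex_Icc 0 1).prod (convex_Icc _ _)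
  have hSD' : Icc (0 : ℝ) 1 ×ˢ I ⊆ halfPlane := prod_mono Icc_subset_Ici_self (subset_univ _)
  obtain ⟨C₁, hC₁, h₁⟩ := ContDiffOn.exists_taylor_le (D := quadrant) h.smooth_M
    uniqueDiffOn_quadrant hS hSc hSD
  obtain ⟨C₂, hC₂, h₂⟩ := h.contDiffOn_partialA.exists_norm_sub_le uniqueDiffOn_quadrant hS hSc hSD
  obtain ⟨C₃, hC₃, h₃⟩ := h.contDiffOn_partialB.exists_norm_sub_le uniqueDiffOn_quadrant hS hSc hSD
  obtain ⟨C₄, hC₄, h₄⟩ := ContDiffOn.exists_norm_sub_le (D := halfPlane) h.smooth_V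
    uniqueDiffOn_halfPlane hS' hSc' hSD'
  obtain ⟨C₅, h₅⟩ := hS'.exists_bound_of_continuousOn
    (h.contDiffOn_partialV.continuousOn.mono hSD')
  have h01 : (0 : ℝ) ∈ Icc (0 : ℝ) 1 := ⟨le_rfl, zero_le_one⟩
  refine ⟨C₁ + C₂ + C₃ + C₄ + |C₅| + 1, by positivity, fun u hu a ha b hb => ?_⟩
  have h5 : 0 ≤ |C₅| := abs_nonneg _
  have hp₀ : ((0 : ℝ), (0 : ℝ), u) ∈ Icc (0 : ℝ) 1 ×ˢ (Icc (0 : ℝ) 1 ×ˢ I) := ⟨h01, h01, hu⟩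
  have hp : (a, b, u) ∈ Icc (0 : ℝ) 1 ×ˢ (Icc (0 : ℝ) 1 ×ˢ I) := ⟨ha, hb, hu⟩
  have hsub : ((a, b, u) : ℝ × ℝ × ℝ) - (0, 0, u) = (a, b, 0) := by simp
  have hn : ‖((a, b, 0) : ℝ × ℝ × ℝ)‖ ≤ a + b := by
    simp only [Prod.norm_def, norm_zero, Real.norm_eq_abs, abs_of_nonneg ha.1, abs_of_nonneg hb.1]
    refine max_le (by linarith [hb.1]) (max_le (by linarith [ha.1]) (by linarith [ha.1, hb.1]))
  have hn' : ‖((a, 0) : ℝ × ℝ)‖ = a := by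
    simp only [Prod.norm_def, norm_zero, Real.norm_eq_abs, abs_of_nonneg ha.1]
    exact max_eq_left ha.1
  have hab : 0 ≤ a + b := add_nonneg ha.1 hb.1
  refine ⟨?_, ?_, ?_, ?_, ?_⟩
  · have := h₁ _ hp₀ _ hp
    rw [hsub] at this
    have e : ((a, b, 0) : ℝ × ℝ × ℝ) = a • (1, 0, 0) + b • (0, 1, 0) := by simp
    rw [e, map_add, map_smul, map_smul, ← e] at this
    refine (le_of_eq ?_).trans (this.trans ?_)
    · rfl
    · calc _ ≤ C₁ * (a + b) ^ 2 := by gcongr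
        _ ≤ _ := by gcongr; linarith
  · have := h₂ _ hp₀ _ hp
    rw [hsub] at this
    refine this.trans ?_
    calc _ ≤ C₂ * (a + b) := by gcongr
        _ ≤ _ := by gcongr; linarith
  · have := h₃ _ hp₀ _ hp
    rw [hsub] at this
    refine this.trans ?_
    calc _ ≤ C₃ * (a + b) := by gcongr
        _ ≤ _ := by gcongr; linarith
  · have := h₄ (0, u) ⟨h01, hu⟩ (a, u) ⟨ha, hu⟩
    rw [show ((a, u) : ℝ × ℝ) - (0, u) = (a, 0) by simp, hn'] at this
    refine this.trans ?_
    have := ha.1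
    gcongr; linarith
  · refine (h₅ (a, u) ⟨ha, hu⟩).trans ?_
    linarith [le_abs_self C₅]

theorem quarticX_div (h : IsSlowFastSystem f M V τ) {u : ℝ} (hu : f u < 0) :
    quarticX M V u / -f u = aspect f M u ^ 2 * (1 + V 0 u) := by
  rw [h.aspect_sq hu, quarticX]; ring

theorem quarticY_div (h : IsSlowFastSystem f M V τ) {u : ℝ} (hu : f u < 0) :
    quarticY f M u / -f u = partialB M (0, 0, u) / aspect f M u ^ 2 := by
  have := (h.mass_pos u).ne'
  have hf : f u ≠ 0 := hu.ne
  rw [h.aspect_sq hu, quarticY]; field_simp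

/-- Replacing the nonlinear forces by their leading quartic parts costs `O(ε (-u)^{-3/2})`. -/
theorem exists_force_bounds (h : IsSlowFastSystem f M V τ) {K : ℝ} (hK : 0 < K) :
    ∃ c A, 0 < c ∧ 0 < A ∧ ∀ ε u z w, 0 < ε → u ∈ Ico (-(π - τ / 2)) 0 → ε / √(-u) ^ 3 ≤ c →
      0 < z → z ≤ K →
      |forceX f M V ε u z w - 2 * z * (sin w ^ 2 * (quarticXY f M u / -f u)
        + 2 * cos w ^ 2 * (quarticX M V u / -f u))| ≤ A * (ε / √(-u) ^ 3) ∧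
      |forceY f M ε u z w - 2 * z * (cos w ^ 2 * (quarticXY f M u / -f u)
        + 2 * sin w ^ 2 * (quarticY f M u / -f u))| ≤ A * (ε / √(-u) ^ 3) := by
  obtain ⟨C, hC, hκC⟩ := h.exists_aspect_bounds
  obtain ⟨L, hL, hTay⟩ := h.exists_taylor_bounds
  have hT : 0 < π - τ / 2 := by linarith [h.tau_lt]
  set T := π - τ / 2 with hTdef
  -- the smallness of `ε (-u)^{-3/2}` keeps `x²` and `y²` in `[0, 1]`, where Taylor applies
  refine ⟨1 / (2 * K * C * T), 4 * L * C * (4 * K * C) ^ 2, by positivity, by positivity, ?_⟩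
  intro ε u z w hε hu hεu hz hzK
  have hf := h.f_neg_of_mem_Ico hu
  have hκ := h.aspect_pos hf
  obtain ⟨hκ1, hκ2⟩ := hκC u hu
  rw [h.quarticX_div hf, h.quarticY_div hf, quarticXY_div hf]
  have hr : 0 < √(-u) := Real.sqrt_pos.2 (by linarith [hu.2])
  have hrT : √(-u) ^ 2 ≤ T := by rw [Real.sq_sqrt (by linarith [hu.2])]; linarith [hu.1]
  set r := √(-u) with hrdef
  set κ := aspect f M u with hκdef
  set a := sqX f M ε u z w with ha
  set b := sqY f M ε u z w with hb
  have ha' : a = 2 * ε * z * κ * cos w ^ 2 := rfl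
  have hb' : b = 2 * ε * z / κ * sin w ^ 2 := rfl
  have hFX : forceX f M V ε u z w = κ / ε * (b * partialA M (a, b, u) + 2 * a * (1 + V a u)
      + a ^ 2 * partialV V (a, u)) := rfl
  have hFY : forceY f M ε u z w = 1 / (ε * κ) * (M a b u - M 0 0 u + b * partialB M (a, b, u)) :=
    rfl
  rw [hFX, hFY]
  clear_value a b κ r
  have hεr : 2 * ε * K * (C / r) ≤ 1 := by
    have : 2 * ε * K * (C / r) = 2 * K * C * (ε / r ^ 3) * r ^ 2 := by field_simp
    rw [this]
    calc _ ≤ 2 * K * C * (1 / (2 * K * C * T)) * T := by gcongr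
      _ = 1 := by field_simp
  have ha0 : 0 ≤ a := by rw [ha']; positivity
  have hb0 : 0 ≤ b := by rw [hb']; positivity
  have haC : a ≤ 2 * ε * K * (C / r) := by
    rw [ha']
    calc _ ≤ 2 * ε * K * (C / r) * 1 := by gcongr; exact cos_sq_le_one w
      _ = _ := mul_one _
  have hbC : b ≤ 2 * ε * K * (C / r) := by
    rw [hb', div_eq_mul_one_div]
    calc _ ≤ 2 * ε * K * (C / r) * 1 := by gcongr; exact sin_sq_le_one w
      _ = _ := mul_one _
  obtain ⟨t1, t2, t3, t4, t5⟩ := hTay u ⟨hu.1, hu.2.le⟩ a ⟨ha0, haC.trans hεr⟩ b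
    ⟨hb0, hbC.trans hεr⟩
  have hab : (a + b) ^ 2 ≤ (4 * K * C) ^ 2 * (ε ^ 2 / r ^ 2) := by
    calc (a + b) ^ 2 ≤ (4 * ε * K * (C / r)) ^ 2 := by gcongr; linarith
      _ = _ := by field_simp
  have ha2 : a ^ 2 ≤ (a + b) ^ 2 := by gcongr; linarith
  have hba : b * (a + b) ≤ (a + b) ^ 2 := by nlinarith
  constructor
  · have e : κ / ε * (b * partialA M (a, b, u) + 2 * a * (1 + V a u)
        + a ^ 2 * partialV V (a, u)) - 2 * z * (sin w ^ 2 * partialA M (0, 0, u)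
        + 2 * cos w ^ 2 * (κ ^ 2 * (1 + V 0 u))) = κ / ε * (b * (partialA M (a, b, u)
          - partialA M (0, 0, u)) + 2 * a * (V a u - V 0 u) + a ^ 2 * partialV V (a, u)) := by
      have e1 : 2 * z * (sin w ^ 2 * partialA M (0, 0, u) + 2 * cos w ^ 2 * (κ ^ 2 * (1 + V 0 u)))
          = κ / ε * (b * partialA M (0, 0, u) + 2 * a * (1 + V 0 u)) := by
        rw [ha', hb']; field_simp
      rw [e1]; ring
    rw [e, abs_mul, abs_of_pos (by positivity : 0 < κ / ε)]
    have s : |b * (partialA M (a, b, u) - partialA M (0, 0, u)) + 2 * a * (V a u - V 0 u)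
        + a ^ 2 * partialV V (a, u)| ≤ 4 * L * (a + b) ^ 2 := by
      refine (abs_add_le _ _).trans ((add_le_add_left (abs_add_le _ _) _).trans ?_)
      rw [abs_mul, abs_mul, abs_mul, abs_mul, abs_two, abs_of_nonneg hb0, abs_of_nonneg ha0,
        abs_of_nonneg (sq_nonneg a)]
      calc _ ≤ b * (L * (a + b)) + 2 * a * (L * a) + a ^ 2 * L := by gcongr
        _ = L * (b * (a + b) + 3 * a ^ 2) := by ring
        _ ≤ L * (4 * (a + b) ^ 2) := by gcongr; linarith
        _ = _ := by ring
    calc _ ≤ C / r / ε * (4 * L * ((4 * K * C) ^ 2 * (ε ^ 2 / r ^ 2))) := by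
          gcongr; exact s.trans (by gcongr)
      _ = _ := by field_simp
  · have e : 1 / (ε * κ) * (M a b u - M 0 0 u + b * partialB M (a, b, u))
        - 2 * z * (cos w ^ 2 * partialA M (0, 0, u)
          + 2 * sin w ^ 2 * (partialB M (0, 0, u) / κ ^ 2))
        = 1 / κ / ε * ((M a b u - M 0 0 u
          - (a * partialA M (0, 0, u) + b * partialB M (0, 0, u)))
          + b * (partialB M (a, b, u) - partialB M (0, 0, u))) := by
      have e1 : 2 * z * (cos w ^ 2 * partialA M (0, 0, u)
          + 2 * sin w ^ 2 * (partialB M (0, 0, u) / κ ^ 2))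
          = 1 / κ / ε * (a * partialA M (0, 0, u) + 2 * b * partialB M (0, 0, u)) := by
        rw [ha', hb']; field_simp
      have e2 : 1 / (ε * κ) = 1 / κ / ε := by field_simp
      rw [e1, e2]; ring
    rw [e, abs_mul, abs_of_pos (by positivity : 0 < 1 / κ / ε)]
    have s : |(M a b u - M 0 0 u - (a * partialA M (0, 0, u) + b * partialB M (0, 0, u)))
          + b * (partialB M (a, b, u) - partialB M (0, 0, u))| ≤ 4 * L * (a + b) ^ 2 := by
      refine (abs_add_le _ _).trans ?_
      rw [abs_mul, abs_of_nonneg hb0]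
      calc _ ≤ L * (a + b) ^ 2 + b * (L * (a + b)) :=
            add_le_add t1 (mul_le_mul_of_nonneg_left t3 hb0)
        _ = L * ((a + b) ^ 2 + b * (a + b)) := by ring
        _ ≤ L * (4 * (a + b) ^ 2) := by gcongr; linarith [sq_nonneg (a + b)]
        _ = _ := by ring
    calc _ ≤ C / r / ε * (4 * L * ((4 * K * C) ^ 2 * (ε ^ 2 / r ^ 2))) := by
          gcongr; exact s.trans (by gcongr)
      _ = _ := by field_simp

/-- The equations of motion agree with the averaging normal form up to `O(ε (-u)^{-3/2})`. -/
theorem exists_speed_bounds (h : IsSlowFastSystem f M V τ) {K : ℝ} (hK : 0 < K) :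
    ∃ c A, 0 < c ∧ 0 < A ∧ ∀ ε u z w, 0 < ε → u ∈ Ico (-(π - τ / 2)) 0 → ε / √(-u) ^ 3 ≤ c →
      0 < z → z ≤ K →
      |logSpeed f M V ε u z w - (-(aspectRate f M u * cos (2 * w))
        - harmonicTwo f M V u * z * sin (2 * w) - harmonicFour f M V u * z * sin (4 * w))|
          ≤ A * (ε / √(-u) ^ 3) ∧
      |angleSpeed f M V ε u z w - (-(freq f M u / ε) + 1 / 2 * (aspectRate f M u * sin (2 * w))
        - drift f M V u * z - harmonicTwo f M V u * z * cos (2 * w)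
        - 1 / 2 * (harmonicFour f M V u * z * cos (4 * w)))| ≤ A * (ε / √(-u) ^ 3) := by
  obtain ⟨c, A, hc, hA, hb⟩ := h.exists_force_bounds hK
  refine ⟨c, 2 * A, hc, by positivity, fun ε u z w hε hu hεu hz hzK => ?_⟩
  obtain ⟨b1, b2⟩ := hb ε u z w hε hu hεu hz hzK
  set p := quarticX M V u / -f u with hp
  set n := quarticY f M u / -f u with hn
  set q := quarticXY f M u / -f u with hq
  have e1 : harmonicTwo f M V u = 2 * (p - n) := by rw [harmonicTwo, hp, hn]; ring
  have e2 : harmonicFour f M V u = p + n - q := by rw [harmonicFour, hp, hn, hq]; ring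
  have e3 : drift f M V u = 3 / 2 * p + 3 / 2 * n + 1 / 2 * q := by rw [drift, hp, hn, hq]; ring
  set X := 2 * z * (sin w ^ 2 * q + 2 * cos w ^ 2 * p) with hX
  set Y := 2 * z * (cos w ^ 2 * q + 2 * sin w ^ 2 * n) with hY
  rw [e1, e2, e3, ← logSpeed_main, ← hX, ← hY]
  have hang := angleSpeed_main (z := z) (p := p) (n := n) (q := q) (w := w)
  rw [← hX, ← hY] at hang
  constructor
  · have e : logSpeed f M V ε u z w - (-(aspectRate f M u * cos (2 * w)) + sin (2 * w) * (Y - X))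
        = sin (2 * w) * ((forceY f M ε u z w - Y) - (forceX f M V ε u z w - X)) := by
      rw [logSpeed]; ring
    rw [e, abs_mul]
    calc _ ≤ 1 * (A * (ε / √(-u) ^ 3) + A * (ε / √(-u) ^ 3)) := by
          gcongr
          · exact abs_sin_le_one _
          · exact (abs_sub _ _).trans (add_le_add b2 b1)
      _ = _ := by ring
  · have e : angleSpeed f M V ε u z w - (-(freq f M u / ε)
        + 1 / 2 * (aspectRate f M u * sin (2 * w)) - (3 / 2 * p + 3 / 2 * n + 1 / 2 * q) * z
        - 2 * (p - n) * z * cos (2 * w) - 1 / 2 * ((p + n - q) * z * cos (4 * w)))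
        = -(cos w ^ 2 * (forceX f M V ε u z w - X)) - sin w ^ 2 * (forceY f M ε u z w - Y) := by
      rw [angleSpeed]; linear_combination -hang
    rw [e]
    refine (abs_sub _ _).trans ?_
    rw [abs_neg, abs_mul, abs_mul, abs_of_nonneg (sq_nonneg (cos w)),
      abs_of_nonneg (sq_nonneg (sin w))]
    calc _ ≤ 1 * (A * (ε / √(-u) ^ 3)) + 1 * (A * (ε / √(-u) ^ 3)) := by
          gcongr
          · exact cos_sq_le_one w
          · exact sin_sq_le_one w
      _ = _ := by ring

end IsSlowFastSystem

/-! ### The vector field of the motion -/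

/-- The vector field of the motion in the variables `(log z, w)`. -/
noncomputable def motionField (f : ℝ → ℝ) (M : ℝ → ℝ → ℝ → ℝ) (V : ℝ → ℝ → ℝ) (ε u : ℝ)
    (p : ℝ × ℝ) : ℝ × ℝ :=
  (logSpeed f M V ε u (exp p.1) p.2, angleSpeed f M V ε u (exp p.1) p.2)

namespace IsSlowFastSystem

variable {f : ℝ → ℝ} {M : ℝ → ℝ → ℝ → ℝ} {V : ℝ → ℝ → ℝ} {τ : ℝ}

theorem contDiffOn_motionField (h : IsSlowFastSystem f M V τ) {ε : ℝ} (hε : 0 < ε) :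
    ContDiffOn ℝ ∞ (fun q : ℝ × ℝ × ℝ => motionField f M V ε q.1 q.2)
      (Ioo (τ - 2 * π) 0 ×ˢ univ) := by
  set U : Set (ℝ × ℝ × ℝ) := Ioo (τ - 2 * π) 0 ×ˢ univ with hU
  have hneg : ∀ q ∈ U, f q.1 < 0 := fun q hq => h.f_neg_of_mem hq.1
  have hu : ContDiff ℝ ∞ (fun q : ℝ × ℝ × ℝ => q.1) := contDiff_fst
  have hζ : ContDiff ℝ ∞ (fun q : ℝ × ℝ × ℝ => q.2.1) := contDiff_fst.comp contDiff_snd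
  have hw : ContDiff ℝ ∞ (fun q : ℝ × ℝ × ℝ => q.2.2) := contDiff_snd.comp contDiff_snd
  have hz : ContDiffOn ℝ ∞ (fun q : ℝ × ℝ × ℝ => exp q.2.1) U := hζ.exp.contDiffOn
  have hs : ContDiffOn ℝ ∞ (fun q : ℝ × ℝ × ℝ => sin q.2.2) U := hw.sin.contDiffOn
  have hc : ContDiffOn ℝ ∞ (fun q : ℝ × ℝ × ℝ => cos q.2.2) U := hw.cos.contDiffOn
  have hs2 : ContDiffOn ℝ ∞ (fun q : ℝ × ℝ × ℝ => sin (2 * q.2.2)) U :=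
    (contDiff_const.mul hw).sin.contDiffOn
  have hc2 : ContDiffOn ℝ ∞ (fun q : ℝ × ℝ × ℝ => cos (2 * q.2.2)) U :=
    (contDiff_const.mul hw).cos.contDiffOn
  have hf : ContDiffOn ℝ ∞ (fun q : ℝ × ℝ × ℝ => -f q.1) U :=
    (h.smooth_f.comp hu).neg.contDiffOn
  have hm : ContDiffOn ℝ ∞ (fun q : ℝ × ℝ × ℝ => mass M q.1) U :=
    (h.contDiff_mass.comp hu).contDiffOn
  have hf0 : ∀ q ∈ U, -f q.1 ≠ 0 := fun q hq => by have := hneg q hq; linarith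
  have hm0 : ∀ q ∈ U, mass M q.1 ≠ 0 := fun q _ => (h.mass_pos q.1).ne'
  have hκ : ContDiffOn ℝ ∞ (fun q : ℝ × ℝ × ℝ => aspect f M q.1) U :=
    (hm.div hf hf0).sqrt fun q hq => div_ne_zero (hm0 q hq) (hf0 q hq)
  have hκ0 : ∀ q ∈ U, aspect f M q.1 ≠ 0 := fun q hq => (h.aspect_pos (hneg q hq)).ne'
  have hΩ : ContDiffOn ℝ ∞ (fun q : ℝ × ℝ × ℝ => freq f M q.1) U :=
    (hf.mul hm).sqrt fun q hq => mul_ne_zero (hf0 q hq) (hm0 q hq)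
  have hlam : ContDiffOn ℝ ∞ (fun q : ℝ × ℝ × ℝ => aspectRate f M q.1) U :=
    (h.contDiff_aspectRate_num.comp hu).contDiffOn.div hf hf0
  have ha : ContDiffOn ℝ ∞ (fun q : ℝ × ℝ × ℝ => sqX f M ε q.1 (exp q.2.1) q.2.2) U :=
    ((contDiffOn_const.mul hz).mul hκ).mul (hc.pow 2)
  have hb : ContDiffOn ℝ ∞ (fun q : ℝ × ℝ × ℝ => sqY f M ε q.1 (exp q.2.1) q.2.2) U :=
    ((contDiffOn_const.mul hz).div hκ hκ0).mul (hs.pow 2)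
  have ha0 : ∀ q ∈ U, 0 ≤ sqX f M ε q.1 (exp q.2.1) q.2.2 := fun q hq => by
    have := h.aspect_pos (hneg q hq)
    rw [sqX]; positivity
  have hb0 : ∀ q ∈ U, 0 ≤ sqY f M ε q.1 (exp q.2.1) q.2.2 := fun q hq => by
    have := h.aspect_pos (hneg q hq)
    rw [sqY]; positivity
  have habu := ha.prodMk (hb.prodMk (hu.contDiffOn (s := U)))
  have hau := ha.prodMk (hu.contDiffOn (s := U))
  have hmaps : MapsTo (fun q : ℝ × ℝ × ℝ => (sqX f M ε q.1 (exp q.2.1) q.2.2,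
      sqY f M ε q.1 (exp q.2.1) q.2.2, q.1)) U quadrant :=
    fun q hq => ⟨ha0 q hq, hb0 q hq, mem_univ _⟩
  have hmaps' : MapsTo (fun q : ℝ × ℝ × ℝ => (sqX f M ε q.1 (exp q.2.1) q.2.2, q.1)) U halfPlane :=
    fun q hq => ⟨ha0 q hq, mem_univ _⟩
  have hM := h.smooth_M.comp habu hmaps
  have hMA := h.contDiffOn_partialA.comp habu hmaps
  have hMB := h.contDiffOn_partialB.comp habu hmaps
  have hV := h.smooth_V.comp hau hmaps'
  have hVA := h.contDiffOn_partialV.comp hau hmaps'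
  have hM0 : ContDiffOn ℝ ∞ (fun q : ℝ × ℝ × ℝ => M 0 0 q.1) U := by
    have := hm.sub (contDiffOn_const (c := (1 : ℝ)))
    exact this.congr fun q _ => by rw [mass]; ring
  have hFX : ContDiffOn ℝ ∞ (fun q : ℝ × ℝ × ℝ => forceX f M V ε q.1 (exp q.2.1) q.2.2) U :=
    (hκ.div_const ε).mul (((hb.mul hMA).add ((contDiffOn_const.mul ha).mul
      (contDiffOn_const.add hV))).add ((ha.pow 2).mul hVA))
  have hFY : ContDiffOn ℝ ∞ (fun q : ℝ × ℝ × ℝ => forceY f M ε q.1 (exp q.2.1) q.2.2) U :=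
    (contDiffOn_const.div (contDiffOn_const.mul hκ) fun q hq => mul_ne_zero hε.ne' (hκ0 q hq)).mul
      ((hM.sub hM0).add (hb.mul hMB))
  exact ((hlam.mul hc2).neg.add (hs2.mul (hFY.sub hFX))).prodMk
    ((((hΩ.div_const ε).neg.add (contDiffOn_const.mul (hlam.mul hs2))).sub
      ((hc.pow 2).mul hFX)).sub ((hs.pow 2).mul hFY))

theorem exists_lipschitz_motionField (h : IsSlowFastSystem f M V τ) {ε a b : ℝ} (hε : 0 < ε)
    (hab : Icc a b ⊆ Ioo (τ - 2 * π) 0) (R : ℝ) :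
    ∃ C : NNReal, ∀ u ∈ Icc a b,
      LipschitzOnWith C (motionField f M V ε u) (Metric.closedBall 0 R) := by
  have hUo : IsOpen (Ioo (τ - 2 * π) 0 ×ˢ (univ : Set (ℝ × ℝ))) := isOpen_Ioo.prod isOpen_univ
  obtain ⟨C, hC, hl⟩ := (h.contDiffOn_motionField hε).exists_norm_sub_le hUo.uniqueDiffOn
    (isCompact_Icc.prod (isCompact_closedBall (0 : ℝ × ℝ) R))
    ((convex_Icc a b).prod (convex_closedBall 0 R)) (prod_mono hab (subset_univ _))
  refine ⟨⟨C, hC⟩, fun u hu => LipschitzOnWith.of_dist_le_mul fun p hp q hq => ?_⟩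
  have := hl (u, q) ⟨hu, hq⟩ (u, p) ⟨hu, hp⟩
  rw [dist_eq_norm, dist_eq_norm]
  refine this.trans (le_of_eq ?_)
  have e : ‖((u, p) : ℝ × ℝ × ℝ) - (u, q)‖ = ‖p - q‖ := by
    rw [Prod.mk_sub_mk, sub_self, Prod.norm_def, norm_zero]
    exact max_eq_right (norm_nonneg _)
  rw [e]; rfl

theorem continuousOn_motionField (h : IsSlowFastSystem f M V τ) {ε a b : ℝ} (hε : 0 < ε)
    (hab : Icc a b ⊆ Ioo (τ - 2 * π) 0) (p : ℝ × ℝ) :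
    ContinuousOn (fun u => motionField f M V ε u p) (Icc a b) := by
  have hg : Continuous (fun u : ℝ => (u, p)) := by fun_prop
  have hm : MapsTo (fun u : ℝ => (u, p)) (Icc a b) (Ioo (τ - 2 * π) 0 ×ˢ univ) :=
    fun u hu => ⟨hab hu, mem_univ _⟩
  have hc := (h.contDiffOn_motionField hε).continuousOn
  generalize motionField f M V ε = F at hc ⊢
  exact ContinuousOn.comp (g := fun q : ℝ × ℝ × ℝ => F q.1 q.2) hc hg.continuousOn hm

/-- Solutions of the equations of motion in action-angle variables are unique. -/
theorem motion_unique (h : IsSlowFastSystem f M V τ) {ε a b : ℝ} (hε : 0 < ε)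
    (hab : Icc a b ⊆ Ioo (τ - 2 * π) 0) {p q : ℝ → ℝ × ℝ}
    (hp : ∀ u ∈ Icc a b, HasDerivWithinAt p (motionField f M V ε u (p u)) (Icc a b) u)
    (hq : ∀ u ∈ Icc a b, HasDerivWithinAt q (motionField f M V ε u (q u)) (Icc a b) u)
    (h0 : p a = q a) : EqOn p q (Icc a b) := by
  have hpc : ContinuousOn p (Icc a b) := fun u hu => (hp u hu).continuousWithinAt
  have hqc : ContinuousOn q (Icc a b) := fun u hu => (hq u hu).continuousWithinAt
  obtain ⟨R₁, h₁⟩ := isCompact_Icc.exists_bound_of_continuousOn hpc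
  obtain ⟨R₂, h₂⟩ := isCompact_Icc.exists_bound_of_continuousOn hqc
  obtain ⟨C, hC⟩ := h.exists_lipschitz_motionField hε hab (max R₁ R₂)
  have hici : ∀ {p : ℝ → ℝ × ℝ} {d : ℝ × ℝ} {u : ℝ}, u ∈ Ico a b →
      HasDerivWithinAt p d (Icc a b) u → HasDerivWithinAt p d (Ici u) u := fun hu hd =>
    hd.mono_of_mem_nhdsWithin (Icc_mem_nhdsGE_of_mem hu)
  exact ODE_solution_unique_of_mem_Icc_right (v := motionField f M V ε)
    (s := fun _ => Metric.closedBall 0 (max R₁ R₂))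
    (fun u hu => hC u (Ico_subset_Icc_self hu)) hpc
    (fun u hu => hici hu (hp u (Ico_subset_Icc_self hu)))
    (fun u hu => by
      simpa using Or.inl (h₁ u (Ico_subset_Icc_self hu))) hqc
    (fun u hu => hici hu (hq u (Ico_subset_Icc_self hu)))
    (fun u hu => by
      simpa using Or.inr (h₂ u (Ico_subset_Icc_self hu))) h0

/-- The equations of motion with `log z` cut off at `Z` have solutions on all of `[a, b]`, since
the cut-off vector field is bounded. -/
theorem exists_cutoff_solution (h : IsSlowFastSystem f M V τ) {ε a b Z B : ℝ} (hε : 0 < ε)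
    (hle : a ≤ b) (hab : Icc a b ⊆ Ioo (τ - 2 * π) 0)
    (hB : ∀ u ∈ Icc a b, ∀ p : ℝ × ℝ, p.1 ≤ Z → ‖motionField f M V ε u p‖ ≤ B) (p₀ : ℝ × ℝ) :
    ∃ p : ℝ → ℝ × ℝ, p a = p₀ ∧ ∀ u ∈ Icc a b,
      HasDerivWithinAt p (motionField f M V ε u (min (p u).1 Z, (p u).2)) (Icc a b) u := by
  have hB0 : 0 ≤ B := (norm_nonneg _).trans (hB a ⟨le_rfl, hle⟩ (Z, 0) le_rfl)
  set r : NNReal := ⟨B * (b - a), mul_nonneg hB0 (by linarith)⟩ with hr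
  set cut : ℝ × ℝ → ℝ × ℝ := fun p => (min p.1 Z, p.2) with hcut
  have hcutL : LipschitzWith 1 cut := by
    have h1 : LipschitzWith 1 (fun p : ℝ × ℝ => min p.1 Z) := by
      simpa using LipschitzWith.prod_fst.min_const Z
    simpa using h1.prodMk LipschitzWith.prod_snd
  obtain ⟨R, hR⟩ := ((isCompact_closedBall p₀ (r : ℝ)).image
    hcutL.continuous).isBounded.subset_closedBall 0
  obtain ⟨C, hC⟩ := h.exists_lipschitz_motionField hε hab R
  have hPL : IsPicardLindelof (fun u p => motionField f M V ε u (cut p))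
      (⟨a, le_rfl, hle⟩ : Icc a b) p₀ r 0 ⟨B, hB0⟩ C := by
    refine ⟨fun u hu => ?_, fun p _ => h.continuousOn_motionField hε hab (cut p),
      fun u hu p _ => hB u hu (cut p) (min_le_right _ _), ?_⟩
    · have := (hC u hu).comp (hcutL.lipschitzOnWith (s := Metric.closedBall p₀ r))
        (fun p hp => hR (mem_image_of_mem _ hp))
      rw [mul_one] at this
      exact this
    · have : max (b - a) (a - a) = b - a := by rw [sub_self]; exact max_eq_left (by linarith)
      simp only [this, hr, NNReal.coe_zero, sub_zero]
      exact le_rfl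
  exact hPL.exists_eq_forall_mem_Icc_hasDerivWithinAt₀

end IsSlowFastSystem

/-! ### The integrals of the frequency and of the drift -/

theorem exists_abs_le_sq {N : ℝ → ℝ} (hN : ContDiff ℝ ∞ N) (h0 : N 0 = 0) (h1 : deriv N 0 = 0)
    {T : ℝ} (hT : 0 ≤ T) : ∃ C, 0 ≤ C ∧ ∀ u ∈ Icc (-T) 0, |N u| ≤ C * u ^ 2 := by
  obtain ⟨C, hC, h⟩ := hN.contDiffOn.exists_taylor_le uniqueDiffOn_univ
    (isCompact_Icc (a := -T) (b := 0)) (convex_Icc _ _) (subset_univ _)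
  refine ⟨C, hC, fun u hu => ?_⟩
  have := h 0 ⟨by linarith, le_rfl⟩ u hu
  have e : fderiv ℝ N 0 = 0 := by
    ext; simp [h1]
  rw [fderivWithin_univ, e] at this
  simpa [h0] using this

theorem integral_sqrt_neg {η : ℝ} (hη : 0 ≤ η) :
    ∫ u in (-η)..0, √(-u) = 2 / 3 * (η * √η) := by
  have h1 : ∫ u in (-η)..0, √(-u) = ∫ u in (0 : ℝ)..η, √u := by
    simp
  have h2 : (fun u : ℝ => √u) = fun u => u ^ (1 / 2 : ℝ) := by ext u; rw [Real.sqrt_eq_rpow]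
  rw [h1, h2, integral_rpow (Or.inl (by norm_num)), Real.zero_rpow (by norm_num),
    Real.sqrt_eq_rpow]
  rcases hη.eq_or_lt with h | h
  · rw [← h]; norm_num
  · rw [Real.rpow_add h, Real.rpow_one]; ring

/-- The drift without its pole at `u = 0`. -/
noncomputable def regularDrift (f : ℝ → ℝ) (M : ℝ → ℝ → ℝ → ℝ) (V : ℝ → ℝ → ℝ) (u : ℝ) : ℝ :=
  drift f M V u + 3 / 2 * u⁻¹

/-- An antiderivative of the drift. -/
noncomputable def driftIntegral (f : ℝ → ℝ) (M : ℝ → ℝ → ℝ → ℝ) (V : ℝ → ℝ → ℝ) (τ u : ℝ) : ℝ :=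
  3 / 2 * (log (π - τ / 2) - log (-u)) + ∫ s in (-(π - τ / 2))..u, regularDrift f M V s

/-- The constant `e₄`: the logarithm of it is the regularized integral of the drift. -/
noncomputable def constE₄ (f : ℝ → ℝ) (M : ℝ → ℝ → ℝ → ℝ) (V : ℝ → ℝ → ℝ) (τ : ℝ) : ℝ :=
  exp (3 / 2 * log (π - τ / 2) + ∫ s in (-(π - τ / 2))..0, regularDrift f M V s)

namespace IsSlowFastSystem

variable {f : ℝ → ℝ} {M : ℝ → ℝ → ℝ → ℝ} {V : ℝ → ℝ → ℝ} {τ : ℝ}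

theorem continuous_freq (h : IsSlowFastSystem f M V τ) : Continuous (freq f M) :=
  (h.smooth_f.continuous.neg.mul h.contDiff_mass.continuous).sqrt

theorem exists_freq_sub_sqrt_le (h : IsSlowFastSystem f M V τ) :
    ∃ C, 0 ≤ C ∧ ∀ u ∈ Icc (-(π - τ / 2)) 0, |freq f M u - √(-u)| ≤ C * (-u * √(-u)) := by
  have hT : 0 < π - τ / 2 := by linarith [h.tau_lt]
  have hdf := (h.smooth_f.differentiable (by simp) 0).hasDerivAt
  have hdm := (h.contDiff_mass.differentiable (by simp) 0).hasDerivAt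
  have hm0 : mass M 0 = 1 := by rw [mass, h.M_zero, add_zero]
  obtain ⟨C, hC, hb⟩ := exists_abs_le_sq (N := fun u => -f u * mass M u + u)
    ((h.smooth_f.neg.mul h.contDiff_mass).add contDiff_id) (by simp [h.f_zero])
    (by
      have := ((hdf.fun_neg.fun_mul hdm).fun_add (hasDerivAt_id' 0)).deriv
      rw [this, hm0, h.f_zero, h.deriv_f_zero]; ring) hT.le
  refine ⟨C, hC, fun u hu => ?_⟩
  rcases hu.2.eq_or_lt with h0 | h0
  · simp [h0, freq, h.f_zero]
  have hr : 0 < √(-u) := Real.sqrt_pos.2 (by linarith)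
  have hf := h.f_neg_of_mem_Ico ⟨hu.1, h0⟩
  have hpos : 0 < -f u * mass M u := mul_pos (by linarith) (h.mass_pos u)
  have hΩ : 0 ≤ freq f M u := Real.sqrt_nonneg _
  have e : (freq f M u - √(-u)) * (freq f M u + √(-u)) = -f u * mass M u + u := by
    have e1 : freq f M u * freq f M u = -f u * mass M u := Real.mul_self_sqrt hpos.le
    have e2 : √(-u) * √(-u) = -u := Real.mul_self_sqrt (by linarith)
    linear_combination e1 - e2
  have h2 := hb u hu
  rw [← e, abs_mul, abs_of_pos (by positivity : 0 < freq f M u + √(-u))] at h2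
  have h3 : |freq f M u - √(-u)| * √(-u) ≤ C * u ^ 2 :=
    (mul_le_mul_of_nonneg_left (by linarith) (abs_nonneg _)).trans h2
  have h4 : u ^ 2 = -u * √(-u) * √(-u) := by
    rw [mul_assoc, Real.mul_self_sqrt (by linarith)]; ring
  rw [h4, ← mul_assoc] at h3
  exact le_of_mul_le_mul_right h3 hr

/-- The fast phase accumulated up to `u = -η`. -/
theorem exists_integral_freq (h : IsSlowFastSystem f M V τ) :
    ∃ C, 0 ≤ C ∧ ∀ η, 0 < η → η ≤ π - τ / 2 →
      |(∫ u in (-(π - τ / 2))..(-η), freq f M u) - (constE₃ f M τ - 2 / 3 * (η * √η))|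
        ≤ C * (η ^ 2 * √η) := by
  obtain ⟨C, hC, hb⟩ := h.exists_freq_sub_sqrt_le
  refine ⟨C, hC, fun η hη hηT => ?_⟩
  have hi : ∀ a b, IntervalIntegrable (freq f M) MeasureTheory.volume a b := fun a b =>
    h.continuous_freq.intervalIntegrable a b
  have hs : ∀ a b, IntervalIntegrable (fun u => √(-u)) MeasureTheory.volume a b := fun a b =>
    (continuous_neg.sqrt).intervalIntegrable a b
  have e1 : constE₃ f M τ = ∫ u in (-(π - τ / 2))..0, freq f M u := by
    rw [constE₃]
    simpa [freq, mass] using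
      intervalIntegral.integral_comp_neg (a := 0) (b := π - τ / 2) (freq f M)
  have e2 := intervalIntegral.integral_add_adjacent_intervals (hi (-(π - τ / 2)) (-η)) (hi (-η) 0)
  have e3 := intervalIntegral.integral_sub (hi (-η) 0) (hs (-η) 0)
  have key : |∫ u in (-η)..0, (freq f M u - √(-u))| ≤ C * (η * √η) * |0 - -η| := by
    rw [← Real.norm_eq_abs]
    refine intervalIntegral.norm_integral_le_of_norm_le_const fun u hu => ?_
    rw [Real.norm_eq_abs]
    rw [uIoc_of_le (by linarith)] at hu
    have : √(-u) ≤ √η := Real.sqrt_le_sqrt (by linarith [hu.1])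
    have h0 : 0 ≤ -u := by linarith [hu.2]
    refine (hb u ⟨by linarith [hu.1], hu.2⟩).trans ?_
    gcongr
    linarith [hu.1]
  rw [e3, integral_sqrt_neg hη.le, zero_sub, neg_neg, abs_of_pos hη] at key
  rw [e1, ← e2, ← abs_neg]
  refine le_trans (le_of_eq ?_) (key.trans (le_of_eq ?_))
  · congr 1; ring
  · ring

theorem exists_regularDrift_le (h : IsSlowFastSystem f M V τ) :
    ∃ C, 0 ≤ C ∧ ∀ u ∈ Ico (-(π - τ / 2)) 0, |regularDrift f M V u| ≤ C := by
  have hT : 0 < π - τ / 2 := by linarith [h.tau_lt]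
  obtain ⟨c, hc, hfc⟩ := h.exists_mul_le_neg_f
  set g : ℝ → ℝ := fun u => 3 / 2 * quarticX M V u + 3 / 2 * quarticY f M u
    + 1 / 2 * quarticXY f M u with hg
  have hgs : ContDiff ℝ ∞ g := ((contDiff_const.mul h.contDiff_quarticX).add
    (contDiff_const.mul h.contDiff_quarticY)).add (contDiff_const.mul h.contDiff_quarticXY)
  have hg0 : g 0 = 3 / 2 := by
    simp [hg, quarticX, quarticY, quarticXY, mass, h.M_zero, h.V_zero, h.f_zero]
  have hdf := (h.smooth_f.differentiable (by simp) 0).hasDerivAt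
  have hdg := (hgs.differentiable (by simp) 0).hasDerivAt
  -- `g(u) u - 3/2 f(u)` vanishes to second order, since `g(0) = 3/2` and `f'(0) = 1`
  obtain ⟨C, hC, hb⟩ := exists_abs_le_sq (N := fun u => g u * u - 3 / 2 * f u)
    ((hgs.mul contDiff_id).sub (contDiff_const.mul h.smooth_f)) (by simp [h.f_zero])
    (by
      have := ((hdg.fun_mul (hasDerivAt_id' 0)).fun_sub (hdf.const_mul (3 / 2))).deriv
      rw [this, hg0, h.deriv_f_zero]; ring) hT.le
  refine ⟨C / c, by positivity, fun u hu => ?_⟩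
  have hf := h.f_neg_of_mem_Ico hu
  have hf0 : f u ≠ 0 := hf.ne
  have hu0 : u ≠ 0 := hu.2.ne
  have e : regularDrift f M V u = (g u * u - 3 / 2 * f u) / (-f u * u) := by
    rw [regularDrift, drift]
    simp only [hg]
    field_simp
    ring
  have hu1 : 0 < -u := by linarith [hu.2]
  have hfu : 0 < -f u := by linarith
  have h1 := hfc u ⟨hu.1, hu.2.le⟩
  rw [e, abs_div, div_le_div_iff₀ (abs_pos.2 (mul_ne_zero hfu.ne' hu0)) hc, abs_mul,
    abs_of_pos hfu, abs_of_neg hu.2]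
  calc _ ≤ C * u ^ 2 * c := by gcongr; exact hb u ⟨hu.1, hu.2.le⟩
    _ = C * (c * -u * -u) := by ring
    _ ≤ C * (-f u * -u) := by gcongr

theorem measurable_regularDrift (h : IsSlowFastSystem f M V τ) :
    Measurable (regularDrift f M V) := by
  have hgs : Continuous (fun u => 3 / 2 * quarticX M V u + 3 / 2 * quarticY f M u
      + 1 / 2 * quarticXY f M u) := ((continuous_const.mul h.contDiff_quarticX.continuous).add
    (continuous_const.mul h.contDiff_quarticY.continuous)).add
      (continuous_const.mul h.contDiff_quarticXY.continuous)
  exact (hgs.measurable.div h.smooth_f.continuous.neg.measurable).add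
    (measurable_const.mul measurable_inv)

theorem intervalIntegrable_regularDrift (h : IsSlowFastSystem f M V τ) {a b : ℝ}
    (ha : a ∈ Icc (-(π - τ / 2)) 0) (hb : b ∈ Icc (-(π - τ / 2)) 0) :
    IntervalIntegrable (regularDrift f M V) MeasureTheory.volume a b := by
  obtain ⟨C, hC, hbd⟩ := h.exists_regularDrift_le
  have hT : -(π - τ / 2) ≤ 0 := by linarith [h.tau_lt]
  have key : IntervalIntegrable (regularDrift f M V) MeasureTheory.volume (-(π - τ / 2)) 0 := by
    rw [intervalIntegrable_iff_integrableOn_Ico_of_le hT]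
    refine MeasureTheory.Measure.integrableOn_of_bounded (M := C) (by simp)
      h.measurable_regularDrift.aestronglyMeasurable ?_
    exact (MeasureTheory.ae_restrict_iff' measurableSet_Ico).2
      (Filter.Eventually.of_forall fun u hu => hbd u hu)
  refine key.mono_set ?_
  rw [uIcc_of_le hT]
  exact uIcc_subset_Icc ha hb

theorem hasDerivAt_driftIntegral (h : IsSlowFastSystem f M V τ) {u : ℝ}
    (hu : u ∈ Ico (-(π - τ / 2)) 0) :
    HasDerivAt (driftIntegral f M V τ) (drift f M V u) u := by
  obtain ⟨a, A, -, -, hcoef⟩ := h.exists_coeff_bounds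
  have hd := (hcoef A le_rfl).2.2.2.2.hasDerivAt u hu
  have hu0 : u ≠ 0 := hu.2.ne
  have hc : ContinuousAt (regularDrift f M V) u :=
    hd.continuousAt.add (continuousAt_const.mul (continuousAt_inv₀ hu0))
  have hT : -(π - τ / 2) ≤ 0 := by linarith [h.tau_lt]
  have h1 := intervalIntegral.integral_hasDerivAt_right
    (h.intervalIntegrable_regularDrift ⟨le_rfl, hT⟩ ⟨hu.1, hu.2.le⟩)
    (h.measurable_regularDrift.stronglyMeasurable.stronglyMeasurableAtFilter) hc
  have h2 := (((hasDerivAt_neg u).log (by simpa using hu0)).const_sub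
    (log (π - τ / 2))).const_mul (3 / 2 : ℝ)
  refine (h2.add h1).congr_deriv ?_
  rw [regularDrift]
  field_simp
  ring

theorem driftIntegral_left : driftIntegral f M V τ (-(π - τ / 2)) = 0 := by
  simp [driftIntegral]

theorem exists_driftIntegral_sub_le (h : IsSlowFastSystem f M V τ) :
    ∃ C, 0 ≤ C ∧ ∀ η, 0 < η → η ≤ π - τ / 2 →
      |driftIntegral f M V τ (-η) - (log (constE₄ f M V τ) - 3 / 2 * log η)| ≤ C * η := by
  obtain ⟨C, hC, hbd⟩ := h.exists_regularDrift_le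
  refine ⟨C, hC, fun η hη hηT => ?_⟩
  have hT : -(π - τ / 2) ≤ 0 := by linarith
  have e := intervalIntegral.integral_add_adjacent_intervals
    (h.intervalIntegrable_regularDrift (a := -(π - τ / 2)) (b := -η) ⟨le_rfl, hT⟩
      ⟨by linarith, by linarith⟩)
    (h.intervalIntegrable_regularDrift (a := -η) (b := 0) ⟨by linarith, by linarith⟩ ⟨hT, le_rfl⟩)
  have key : |∫ u in (-η)..0, regularDrift f M V u| ≤ C * |0 - -η| := by
    rw [← Real.norm_eq_abs]
    refine intervalIntegral.norm_integral_le_of_norm_le_const_ae ?_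
    have h0 : ∀ᵐ u : ℝ, u ≠ 0 := by simp [MeasureTheory.ae_iff]
    filter_upwards [h0] with u hu0 hu
    rw [uIoc_of_le (by linarith)] at hu
    exact hbd u ⟨by linarith [hu.1], lt_of_le_of_ne hu.2 hu0⟩
  rw [zero_sub, neg_neg, abs_of_pos hη] at key
  rw [driftIntegral, constE₄, Real.log_exp, ← e, neg_neg, ← abs_neg]
  refine le_trans (le_of_eq ?_) key
  congr 1; ring

end IsSlowFastSystem

/-! ### Solutions up to the end point -/

theorem HasDerivWithinAt.fst_prod {p : ℝ → ℝ × ℝ} {d : ℝ × ℝ} {s : Set ℝ} {u : ℝ}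
    (h : HasDerivWithinAt p d s u) : HasDerivWithinAt (fun u => (p u).1) d.1 s u :=
  (hasFDerivAt_fst (𝕜 := ℝ) (p := p u)).comp_hasDerivWithinAt u h

theorem HasDerivWithinAt.snd_prod {p : ℝ → ℝ × ℝ} {d : ℝ × ℝ} {s : Set ℝ} {u : ℝ}
    (h : HasDerivWithinAt p d s u) : HasDerivWithinAt (fun u => (p u).2) d.2 s u :=
  (hasFDerivAt_snd (𝕜 := ℝ) (p := p u)).comp_hasDerivWithinAt u h

namespace IsSlowFastSystem

variable {f : ℝ → ℝ} {M : ℝ → ℝ → ℝ → ℝ} {V : ℝ → ℝ → ℝ} {τ : ℝ}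

/-- Away from `u = 0` and for bounded `z` the vector field of the motion is bounded. -/
theorem exists_motionField_le (h : IsSlowFastSystem f M V τ) {K : ℝ} (hK : 0 < K) :
    ∃ c, 0 < c ∧ ∀ ε η, 0 < ε → 0 < η → ε / √η ^ 3 ≤ c →
      ∃ B, ∀ u ∈ Icc (-(π - τ / 2)) (-η), ∀ p : ℝ × ℝ, p.1 ≤ log K →
        ‖motionField f M V ε u p‖ ≤ B := by
  obtain ⟨c, A₁, hc, hA₁, hsp⟩ := h.exists_speed_bounds hK
  obtain ⟨a, A, ha, hA, hco⟩ := h.exists_coeff_bounds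
  obtain ⟨-, hl, h2, h4, hd⟩ := hco A le_rfl
  obtain ⟨F, hF, hΩ⟩ := h.continuous_freq.exists_abs_le (-(π - τ / 2)) 0
  refine ⟨c, hc, fun ε η hε hη hP => ?_⟩
  set N := A / √η ^ 2 with hN
  set P := ε / √η ^ 3 with hPdef
  refine ⟨F / ε + N + 3 * (N * K) + A₁ * P, fun u hu p hp => ?_⟩
  have hr0 : 0 < √η := Real.sqrt_pos.2 hη
  have hrr : √η ≤ √(-u) := Real.sqrt_le_sqrt (by linarith [hu.2])
  have huI : u ∈ Ico (-(π - τ / 2)) 0 := ⟨hu.1, by linarith [hu.2]⟩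
  have hPu : ε / √(-u) ^ 3 ≤ P := by rw [hPdef]; gcongr
  have hNu : A / √(-u) ^ 2 ≤ N := by rw [hN]; gcongr
  have hz : exp p.1 ≤ K := by rw [← Real.exp_log hK]; exact Real.exp_le_exp.2 hp
  have hz' : |exp p.1| ≤ K := by rwa [abs_of_pos (Real.exp_pos _)]
  obtain ⟨s1, s2⟩ := hsp ε u (exp p.1) p.2 hε huI (hPu.trans hP) (Real.exp_pos _) hz
  have s1' := abs_le.1 (s1.trans (mul_le_mul_of_nonneg_left hPu hA₁.le))
  have s2' := abs_le.1 (s2.trans (mul_le_mul_of_nonneg_left hPu hA₁.le))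
  have hone : |(1 : ℝ)| ≤ 1 := by simp
  have b1 := abs_le.1 (abs_mul_mul_le_of_abs_le_one ((hl.abs_le u huI).trans hNu) hone
    (abs_cos_le_one (2 * p.2)))
  have b2 := abs_le.1 (abs_mul_mul_le_of_abs_le_one ((hl.abs_le u huI).trans hNu) hone
    (abs_sin_le_one (2 * p.2)))
  have b3 := abs_le.1 (abs_mul_mul_le_of_abs_le_one ((h2.abs_le u huI).trans hNu) hz'
    (abs_cos_le_one (2 * p.2)))
  have b4 := abs_le.1 (abs_mul_mul_le_of_abs_le_one ((h2.abs_le u huI).trans hNu) hz'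
    (abs_sin_le_one (2 * p.2)))
  have b5 := abs_le.1 (abs_mul_mul_le_of_abs_le_one ((h4.abs_le u huI).trans hNu) hz'
    (abs_cos_le_one (4 * p.2)))
  have b6 := abs_le.1 (abs_mul_mul_le_of_abs_le_one ((h4.abs_le u huI).trans hNu) hz'
    (abs_sin_le_one (4 * p.2)))
  have b7 := abs_le.1 (abs_mul_mul_le_of_abs_le_one ((hd.abs_le u huI).trans hNu) hz' hone)
  have b8 : |freq f M u / ε| ≤ F / ε := by
    rw [abs_div, abs_of_pos hε]; gcongr; exact hΩ u ⟨huI.1, huI.2.le⟩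
  have b8' := abs_le.1 b8
  have hN0 : 0 ≤ N := by positivity
  have hNK : 0 ≤ N * K := by positivity
  simp only [mul_one] at b1 b2 b7
  rw [motionField, Prod.norm_def]
  refine max_le (abs_le.2 ⟨?_, ?_⟩) (abs_le.2 ⟨?_, ?_⟩) <;> dsimp only <;>
    linarith [s1'.1, s1'.2, s2'.1, s2'.2, b1.1, b1.2, b2.1, b2.2, b3.1, b3.2, b4.1, b4.2, b5.1,
      b5.2, b6.1, b6.2, b7.1, b7.2, b8'.1, b8'.2]

theorem Icc_subset_Ioo (h : IsSlowFastSystem f M V τ) {η : ℝ} (hη : 0 < η) :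
    Icc (-(π - τ / 2)) (-η) ⊆ Ioo (τ - 2 * π) 0 :=
  fun u hu => ⟨by linarith [hu.1, h.tau_lt], by linarith [hu.2]⟩

/-- The solution with given initial values exists up to `u = -η`, and averaging describes it there
up to `O(ε η^{-3/2})`. -/
theorem exists_solution (h : IsSlowFastSystem f M V τ) {K : ℝ} (hK : 0 < K) :
    ∃ c C, 0 < c ∧ 0 < C ∧ ∀ ε η z₀ w₀, 0 < ε → 0 < η → η ≤ π - τ / 2 → ε / √η ^ 3 ≤ c →
      0 < z₀ → z₀ ≤ K →
      ∃ p : ℝ → ℝ × ℝ, p (-(π - τ / 2)) = (log z₀, w₀) ∧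
        (∀ u ∈ Icc (-(π - τ / 2)) (-η), HasDerivWithinAt p (motionField f M V ε u (p u))
          (Icc (-(π - τ / 2)) (-η)) u) ∧
        |exp (p (-η)).1 - z₀| ≤ C * (ε / √η ^ 3) ∧
        |(p (-η)).2 - w₀ + (∫ u in (-(π - τ / 2))..(-η), freq f M u) / ε
          + z₀ * driftIntegral f M V τ (-η)| ≤ C * (ε / √η ^ 3) := by
  have hT : 0 < π - τ / 2 := by linarith [h.tau_lt]
  have h2K : 0 < 2 * K := by positivity
  obtain ⟨c₁, hc₁, hbound⟩ := h.exists_motionField_le h2K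
  obtain ⟨c₂, A₁, hc₂, hA₁, hsp⟩ := h.exists_speed_bounds h2K
  obtain ⟨a, A₂, ha, hA₂, hco⟩ := h.exists_coeff_bounds
  obtain ⟨hΩ, hl, h2, h4, hd⟩ := hco (A₁ + A₂) (by linarith)
  obtain ⟨C, hC, hav⟩ := exists_averaging_const hT ha (add_pos hA₁ hA₂) h2K
  refine ⟨min (min c₁ c₂) (min 1 (K / (2 * C))), C, by positivity, hC, ?_⟩
  intro ε η z₀ w₀ hε hη hηT hP hz₀ hz₀K
  have hP1 : ε / √η ^ 3 ≤ c₁ := hP.trans ((min_le_left _ _).trans (min_le_left _ _))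
  have hP2 : ε / √η ^ 3 ≤ c₂ := hP.trans ((min_le_left _ _).trans (min_le_right _ _))
  have hP3 : ε / √η ^ 3 ≤ 1 := hP.trans ((min_le_right _ _).trans (min_le_left _ _))
  have hP4 : C * (ε / √η ^ 3) ≤ K / 2 := by
    have : ε / √η ^ 3 ≤ K / (2 * C) := hP.trans ((min_le_right _ _).trans (min_le_right _ _))
    calc _ ≤ C * (K / (2 * C)) := by gcongr
      _ = K / 2 := by field_simp
  set T := π - τ / 2 with hTdef
  have hle : -T ≤ -η := by linarith
  obtain ⟨B, hB⟩ := hbound ε η hε hη hP1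
  obtain ⟨p, hp0, hp⟩ := h.exists_cutoff_solution hε hle (h.Icc_subset_Ioo hη) hB (log z₀, w₀)
  have hr0 : 0 < √η := Real.sqrt_pos.2 hη
  have hPt : ∀ t ∈ Icc (-T) (-η), ε / √(-t) ^ 3 ≤ ε / √η ^ 3 := by
    intro t ht
    have : √η ≤ √(-t) := Real.sqrt_le_sqrt (by linarith [ht.2])
    gcongr
  have hz0 : exp (p (-T)).1 = z₀ := by rw [hp0]; exact Real.exp_log hz₀
  -- as long as the cutoff is not active, the solution is nearly averaged
  have key : ∀ t ∈ Icc (-T) (-η), (∀ u ∈ Icc (-T) t, exp (p u).1 ≤ 2 * K) →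
      |exp (p t).1 - exp (p (-T)).1| ≤ C * (ε / √(-t) ^ 3) ∧
      |(p t).2 - (p (-T)).2 + ((∫ u in (-T)..t, freq f M u) - ∫ u in (-T)..(-T), freq f M u) / ε
        + exp (p (-T)).1 * (driftIntegral f M V τ t - driftIntegral f M V τ (-T))|
        ≤ C * (ε / √(-t) ^ 3) := by
    intro t ht hzt
    have ht0 : t < 0 := by linarith [ht.2]
    have hsub : Icc (-T) t ⊆ Icc (-T) (-η) := Icc_subset_Icc_right ht.2
    have hIco : ∀ u ∈ Icc (-T) t, u ∈ Ico (-T) 0 := fun u hu => ⟨hu.1, hu.2.trans_lt ht0⟩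
    have hmove : ∀ u ∈ Icc (-T) t,
        HasDerivWithinAt p (motionField f M V ε u (p u)) (Icc (-T) t) u := by
      intro u hu
      have := (hp u (hsub hu)).mono hsub
      rwa [min_eq_left ((Real.le_log_iff_exp_le h2K).2 (hzt u hu))] at this
    have hnear : NearlyAveraged T (A₁ + A₂) ε t (freq f M) (aspectRate f M) (harmonicTwo f M V)
        (harmonicFour f M V) (drift f M V) (fun u => (p u).1) (fun u => (p u).2) := by
      have hs : ∀ u ∈ Icc (-T) t, _ := fun u hu => hsp ε u (exp (p u).1) (p u).2 hε (hIco u hu)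
        ((hPt u (hsub hu)).trans hP2) (Real.exp_pos _) (hzt u hu)
      have hA : ∀ u, A₁ * (ε / √(-u) ^ 3) ≤ (A₁ + A₂) * (ε / √(-u) ^ 3) := fun u => by
        gcongr; linarith
      refine ⟨fun u hu => ⟨_, (hs u hu).1.trans (hA u), ?_⟩,
        fun u hu => ⟨_, (hs u hu).2.trans (hA u), ?_⟩⟩
      · exact (hmove u hu).fst_prod.congr_deriv (by rw [motionField]; ring)
      · exact (hmove u hu).snd_prod.congr_deriv (by rw [motionField]; ring)
    exact (hav hε ht0 ht.1 hΩ hl h2 h4 hd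
      (IΩ := fun s => ∫ u in (-T)..s, freq f M u) (IB := driftIntegral f M V τ)
      (fun u _ => (intervalIntegral.integral_hasDerivAt_right
        (h.continuous_freq.intervalIntegrable _ _)
        h.continuous_freq.stronglyMeasurable.stronglyMeasurableAtFilter
        h.continuous_freq.continuousAt).hasDerivWithinAt)
      (fun u hu => (h.hasDerivAt_driftIntegral (hIco u hu)).hasDerivWithinAt) hnear hzt
      ((hPt t ht).trans hP3)).2
  have hcont : ContinuousOn (fun u => exp (p u).1) (Icc (-T) (-η)) := fun u hu =>
    ((hp u hu).continuousWithinAt.fst).rexp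
  have hz2K : ∀ t ∈ Icc (-T) (-η), exp (p t).1 ≤ 2 * K := by
    refine hcont.le_of_bootstrap (B' := 3 / 2 * K) (by linarith) ?_ fun t ht hzt => ?_
    · rw [hz0]; linarith
    · have h1 := (key t ht hzt).1.trans ((mul_le_mul_of_nonneg_left (hPt t ht) hC.le).trans hP4)
      rw [hz0] at h1
      have := (abs_le.1 h1).2
      linarith
  have hend : -η ∈ Icc (-T) (-η) := ⟨hle, le_rfl⟩
  have hfin := key (-η) hend hz2K
  rw [hz0, neg_neg, hp0, intervalIntegral.integral_same, sub_zero, hTdef, driftIntegral_left,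
    sub_zero] at hfin
  refine ⟨p, hp0, fun u hu => ?_, hfin⟩
  have := hp u hu
  rwa [min_eq_left ((Real.le_log_iff_exp_le h2K).2 (hz2K u hu))] at this

/-- The outer map is the flow of the vector field of the motion. -/
theorem outerMap_iff (h : IsSlowFastSystem f M V τ) {ε δ us z₀ w₀ : ℝ} {q : ℝ × ℝ} (hε : 0 < ε)
    (hδ : 0 < δ) (hη : 0 < scaleMu ε δ ^ 2 * us) (hηT : scaleMu ε δ ^ 2 * us < π - τ / 2)
    (hz₀ : 0 < z₀) :
    OuterMap f M V τ ε δ us (z₀, w₀) q ↔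
      ∃ p : ℝ → ℝ × ℝ, p (-(π - τ / 2)) = (log z₀, w₀) ∧
        (∀ u ∈ Icc (-(π - τ / 2)) (-(scaleMu ε δ ^ 2 * us)),
          HasDerivWithinAt p (motionField f M V ε u (p u))
            (Icc (-(π - τ / 2)) (-(scaleMu ε δ ^ 2 * us))) u) ∧
        q = (exp (p (-(scaleMu ε δ ^ 2 * us))).1, (p (-(scaleMu ε δ ^ 2 * us))).2) := by
  rw [OuterMap, show -π + τ / 2 = -(π - τ / 2) by ring]
  set η := scaleMu ε δ ^ 2 * us with hηdef
  set a := -(π - τ / 2) with ha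
  have hab : a < -η := by linarith
  have hf : ∀ u ∈ Icc a (-η), f u < 0 := fun u hu => h.f_neg_of_mem (h.Icc_subset_Ioo hη hu)
  have haI : a ∈ Icc a (-η) := ⟨le_rfl, hab.le⟩
  have hbI : -η ∈ Icc a (-η) := ⟨hab.le, le_rfl⟩
  constructor
  · rintro ⟨z, w, hz, hw, hpos, hsol, hini, hfin⟩
    rw [Prod.mk.injEq] at hini
    refine ⟨fun u => (log (z u), w u), by simp only [hini.1, hini.2], fun u hu => ?_, ?_⟩
    · have hzu := hpos u hu
      have hdz := (hz u hu).hasDerivWithinAt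
      have hdw := (hw u hu).hasDerivWithinAt
      have hdz' : HasDerivWithinAt z (z u * (derivWithin z (Icc a (-η)) u / z u)) (Icc a (-η)) u :=
        hdz.congr_deriv (by field_simp)
      obtain ⟨e1, e2⟩ := (h.motion_iff hε hδ hab hf hpos hu hdz' hdw).1 (hsol u hu)
      refine ((hdz.log hzu.ne').prodMk hdw).congr_deriv ?_
      rw [motionField, e1, e2, Real.exp_log hzu]
    · rw [← hfin, Real.exp_log (hpos _ hbI)]
  · rintro ⟨p, hini, hp, rfl⟩
    have hz : ∀ u ∈ Icc a (-η), HasDerivWithinAt (fun u => exp (p u).1)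
        (exp (p u).1 * logSpeed f M V ε u (exp (p u).1) (p u).2) (Icc a (-η)) u :=
      fun u hu => (hp u hu).fst_prod.exp
    have hw : ∀ u ∈ Icc a (-η), HasDerivWithinAt (fun u => (p u).2)
        (angleSpeed f M V ε u (exp (p u).1) (p u).2) (Icc a (-η)) u :=
      fun u hu => (hp u hu).snd_prod
    refine ⟨fun u => exp (p u).1, fun u => (p u).2,
      fun u hu => (hz u hu).differentiableWithinAt, fun u hu => (hw u hu).differentiableWithinAt,
      fun u _ => Real.exp_pos _, fun u hu => ?_, ?_, rfl⟩
    · exact (h.motion_iff hε hδ hab hf (fun u _ => Real.exp_pos (p u).1) hu (hz u hu) (hw u hu)).2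
        ⟨rfl, rfl⟩
    · simp only [hini, Real.exp_log hz₀]

end IsSlowFastSystem

/-! ### The outer map -/

theorem scaleMu_pow_five {ε δ : ℝ} (hε : 0 < ε) (hδ : 0 < δ) :
    scaleMu ε δ ^ 5 = ε * (ε ^ (2 / 3 : ℝ) * δ ^ (-(5 / 2) : ℝ)) := by
  have e : ε * (ε ^ (2 / 3 : ℝ) * δ ^ (-(5 / 2) : ℝ))
      = ε ^ (1 + 2 / 3 : ℝ) * δ ^ (-(5 / 2) : ℝ) := by
    rw [Real.rpow_add hε, Real.rpow_one]; ring
  rw [e, scaleMu, mul_pow, ← Real.rpow_natCast, ← Real.rpow_natCast, ← Real.rpow_mul hε.le,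
    ← Real.rpow_mul hδ.le]
  norm_num

theorem log_scaleMu {ε δ : ℝ} (hε : 0 < ε) (hδ : 0 < δ) :
    log (scaleMu ε δ) = 1 / 3 * log ε - 1 / 2 * log δ := by
  rw [scaleMu, Real.log_mul (Real.rpow_pos_of_pos hε _).ne' (Real.rpow_pos_of_pos hδ _).ne',
    Real.log_rpow hε, Real.log_rpow hδ]
  ring

theorem sqrt_pow_three_eq_rpow {x : ℝ} (hx : 0 ≤ x) : √x ^ 3 = x ^ (3 / 2 : ℝ) := by
  rw [Real.sqrt_eq_rpow, ← Real.rpow_natCast, ← Real.rpow_mul hx]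
  norm_num

theorem mainTheorem4 (f : ℝ → ℝ) (M : ℝ → ℝ → ℝ → ℝ) (V : ℝ → ℝ → ℝ) (τ : ℝ)
    (hsys : IsSlowFastSystem f M V τ) :
    ∃ e₄ : ℝ, 0 < e₄ ∧
      ∀ us : ℝ, 0 < us → ∀ K : ℝ, 0 < K →
        ∃ c : ℝ, 0 < c ∧ ∃ C : ℝ, 0 < C ∧
          ∀ ε δ : ℝ, 0 < ε → 0 < δ → ε ≤ c → scaleMu ε δ ≤ c →
            δ ^ (3 / 2 : ℝ) * log ε⁻¹ ≤ c →
            ∀ z₀ w₀ : ℝ, 0 < z₀ → z₀ ≤ K →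
              (∃! q : ℝ × ℝ, OuterMap f M V τ ε δ us (z₀, w₀) q) ∧
              ∀ q : ℝ × ℝ, OuterMap f M V τ ε δ us (z₀, w₀) q →
                |q.1 - z₀| ≤ C * (δ ^ (3 / 2 : ℝ) * log ε⁻¹) ∧
                |q.2 - (w₀ - ε⁻¹ * constE₃ f M τ
                    - (log (e₄ * ε⁻¹) - 3 / 2 * log (δ⁻¹ * us)) * z₀
                    + 2 / 3 * δ ^ (-(3 / 2) : ℝ) * us ^ (3 / 2 : ℝ))|
                  ≤ C * (δ ^ (3 / 2 : ℝ) * log ε⁻¹ + ε ^ (2 / 3 : ℝ) * δ ^ (-(5 / 2) : ℝ)) := by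
  obtain ⟨C₂, hC₂, hfreq⟩ := hsys.exists_integral_freq
  obtain ⟨C₃, hC₃, hdrift⟩ := hsys.exists_driftIntegral_sub_le
  have hT : 0 < π - τ / 2 := by linarith [hsys.tau_lt]
  have he₄ : 0 < constE₄ f M V τ := Real.exp_pos _
  refine ⟨constE₄ f M V τ, he₄, fun us hus K hK => ?_⟩
  obtain ⟨c₁, C₁, hc₁, hC₁, hsol⟩ := hsys.exists_solution hK
  set T := π - τ / 2 with hTdef
  set s : ℝ := us ^ (3 / 2 : ℝ) with hs
  have hs0 : 0 < s := Real.rpow_pos_of_pos hus _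
  refine ⟨min (min (exp (-1)) (min 1 (T / (2 * us)))) (min s (c₁ * s)), by positivity,
    C₁ / s + (C₂ + K * C₃) * (us * s), by positivity, ?_⟩
  intro ε δ hε hδ hεc hμc hδc z₀ w₀ hz₀ hz₀K
  have hcε : ε ≤ exp (-1) := hεc.trans ((min_le_left _ _).trans (min_le_left _ _))
  have hcμ : scaleMu ε δ ≤ min 1 (T / (2 * us)) :=
    hμc.trans ((min_le_left _ _).trans (min_le_right _ _))
  have hcδ : δ ^ (3 / 2 : ℝ) * log ε⁻¹ ≤ min s (c₁ * s) := hδc.trans (min_le_right _ _)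
  have hμ := scaleMu_pos hε hδ
  have hD0 : 0 < δ ^ (3 / 2 : ℝ) := Real.rpow_pos_of_pos hδ _
  have hlog : 1 ≤ log ε⁻¹ := by
    rw [Real.log_inv, le_neg]
    simpa using Real.log_le_log hε hcε
  have hDlog : δ ^ (3 / 2 : ℝ) ≤ δ ^ (3 / 2 : ℝ) * log ε⁻¹ := le_mul_of_one_le_right hD0.le hlog
  have h3 := scaleMu_pow_three hε hδ
  have hδ2 : (δ ^ (3 / 4 : ℝ)) ^ 2 = δ ^ (3 / 2 : ℝ) := by
    rw [← Real.rpow_natCast, ← Real.rpow_mul hδ.le]; norm_num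
  rw [hδ2] at h3
  have h5 := scaleMu_pow_five hε hδ
  have hlμ := log_scaleMu hε hδ
  have hη : 0 < scaleMu ε δ ^ 2 * us := by positivity
  have hηT : scaleMu ε δ ^ 2 * us < T := by
    have h1 : scaleMu ε δ ≤ 1 := hcμ.trans (min_le_left _ _)
    have h2 : scaleMu ε δ ≤ T / (2 * us) := hcμ.trans (min_le_right _ _)
    calc scaleMu ε δ ^ 2 * us ≤ (1 * (T / (2 * us))) * us := by
          rw [pow_two]; gcongr
      _ = T / 2 := by field_simp
      _ < T := by linarith
  have hsqrt : √(scaleMu ε δ ^ 2 * us) = scaleMu ε δ * √us := by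
    rw [Real.sqrt_mul (by positivity), Real.sqrt_sq hμ.le]
  have hss : √us ^ 3 = s := sqrt_pow_three_eq_rpow hus.le
  -- the small parameter of averaging, `ε η^{-3/2}` at `η = μ² û_*`, is `δ^{3/2} û_*^{-3/2}`
  have hP : ε / √(scaleMu ε δ ^ 2 * us) ^ 3 = δ ^ (3 / 2 : ℝ) / s := by
    rw [hsqrt, mul_pow, hss]
    nth_rewrite 1 [← h3]
    field_simp
  have hPlog : δ ^ (3 / 2 : ℝ) / s ≤ 1 / s * (δ ^ (3 / 2 : ℝ) * log ε⁻¹) := by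
    rw [div_eq_mul_one_div, mul_comm]; gcongr
  have hPc : ε / √(scaleMu ε δ ^ 2 * us) ^ 3 ≤ c₁ := by
    rw [hP, div_le_iff₀ hs0]
    exact hDlog.trans (hcδ.trans (min_le_right _ _))
  have hP1 : δ ^ (3 / 2 : ℝ) ≤ s := hDlog.trans (hcδ.trans (min_le_left _ _))
  obtain ⟨p, hp0, hp, hz, hw⟩ := hsol ε _ z₀ w₀ hε hη hηT.le hPc hz₀ hz₀K
  have hiff := fun q => hsys.outerMap_iff (w₀ := w₀) (q := q) hε hδ hη hηT hz₀
  have huniq : ∀ q, OuterMap f M V τ ε δ us (z₀, w₀) q →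
      q = (exp (p (-(scaleMu ε δ ^ 2 * us))).1, (p (-(scaleMu ε δ ^ 2 * us))).2) := by
    intro q hq
    obtain ⟨p', hp0', hp', rfl⟩ := (hiff q).1 hq
    have := hsys.motion_unique hε (hsys.Icc_subset_Ioo hη) hp' hp (hp0'.trans hp0.symm)
      ⟨by linarith, le_rfl⟩
    rw [this]
  refine ⟨⟨_, (hiff _).2 ⟨p, hp0, hp, rfl⟩, huniq⟩, fun q hq => ?_⟩
  rw [huniq q hq]
  set η := scaleMu ε δ ^ 2 * us with hηdef
  set X := ε ^ (2 / 3 : ℝ) * δ ^ (-(5 / 2) : ℝ) with hX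
  set L := δ ^ (3 / 2 : ℝ) * log ε⁻¹ with hL
  have hX0 : 0 < X := by positivity
  have hL0 : 0 < L := by positivity
  rw [hP] at hz hw
  have hCP : C₁ * (δ ^ (3 / 2 : ℝ) / s) ≤ C₁ / s * L := by
    calc _ ≤ C₁ * (1 / s * L) := by gcongr
      _ = _ := by ring
  constructor
  · refine (hz.trans hCP).trans ?_
    gcongr
    have : 0 ≤ (C₂ + K * C₃) * (us * s) := by positivity
    linarith
  · have hf := hfreq η hη hηT.le
    have hd := hdrift η hη hηT.le
    set F := ∫ u in (-T)..(-η), freq f M u with hF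
    set D := driftIntegral f M V τ (-η) with hDdef
    have hηs : η * √η = scaleMu ε δ ^ 3 * s := by
      rw [hsqrt, hηdef, ← hss]
      have : √us ^ 2 = us := Real.sq_sqrt hus.le
      linear_combination (-(scaleMu ε δ ^ 3 * √us)) * this
    have hηX : η ^ 2 * √η / ε = us * s * X := by
      have : η ^ 2 * √η = scaleMu ε δ ^ 5 * (us * s) := by
        rw [show η ^ 2 * √η = η * (η * √η) by ring, hηs, hηdef]; ring
      rw [this, h5]; field_simp
    -- the error `O(η)` of the drift integral is absorbed, since `ε ≤ η^{3/2}`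
    have hηle : η ≤ us * s * X := by
      rw [← hηX, le_div_iff₀ hε, show η ^ 2 * √η = η * (η * √η) by ring, hηs]
      have : ε ≤ scaleMu ε δ ^ 3 * s := by
        nth_rewrite 1 [← h3]; gcongr
      gcongr
    have hlead : 2 / 3 * δ ^ (-(3 / 2) : ℝ) * s = 2 / 3 * (η * √η) / ε := by
      rw [hηs, Real.rpow_neg hδ.le]
      nth_rewrite 2 [← h3]
      field_simp
    have hlogs : log (constE₄ f M V τ * ε⁻¹) - 3 / 2 * log (δ⁻¹ * us)
        = log (constE₄ f M V τ) - 3 / 2 * log η := by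
      rw [hηdef, Real.log_mul he₄.ne' (by positivity), Real.log_mul (by positivity) hus.ne',
        Real.log_mul (by positivity) hus.ne', Real.log_pow, hlμ, Real.log_inv, Real.log_inv]
      push_cast
      ring
    rw [hlogs, hlead]
    set Λ := log (constE₄ f M V τ) - 3 / 2 * log η with hΛ
    set E := constE₃ f M τ with hE
    have e : (p (-η)).2 - (w₀ - ε⁻¹ * E - Λ * z₀ + 2 / 3 * (η * √η) / ε)
        = ((p (-η)).2 - w₀ + F / ε + z₀ * D) - (F - (E - 2 / 3 * (η * √η))) / ε
          - z₀ * (D - Λ) := by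
      field_simp; ring
    have b1 : |(F - (E - 2 / 3 * (η * √η))) / ε| ≤ C₂ * (us * s * X) := by
      rw [abs_div, abs_of_pos hε, ← hηX, ← mul_div_assoc]
      gcongr
    have b2 : |z₀ * (D - Λ)| ≤ K * (C₃ * (us * s * X)) := by
      rw [abs_mul, abs_of_pos hz₀]
      gcongr
      exact hd.trans (by gcongr)
    change |(p (-η)).2 - (w₀ - ε⁻¹ * E - Λ * z₀ + 2 / 3 * (η * √η) / ε)| ≤ _
    rw [e]
    calc _ ≤ C₁ / s * L + C₂ * (us * s * X) + K * (C₃ * (us * s * X)) :=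
          (abs_sub _ _).trans (add_le_add ((abs_sub _ _).trans (add_le_add (hw.trans hCP) b1)) b2)
      _ = C₁ / s * L + (C₂ + K * C₃) * (us * s) * X := by ring
      _ ≤ (C₁ / s + (C₂ + K * C₃) * (us * s)) * (L + X) := by
        have q1 : 0 ≤ C₁ / s * X := by positivity
        have q2 : 0 ≤ (C₂ + K * C₃) * (us * s) * L := by positivity
        linarith
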